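/- All manifolds are smooth, $d$-dimensional, Hausdorff and second countable; oriented local diffeomorphisms preserve orientation. An oriented sse groupoid is a topological groupoid whose object space $X_0$ and morphism space $X_1$ are oriented manifolds without boundary, whose structure maps are oriented local diffeomorphisms, and whose stabilizers $G_x$ are finite; it is an ep groupoid if moreover $s\times t:X_1\to X_0\times X_0$ is proper. $|X|$ is the orbit space, $\pi:X_0\to|X|$ the projection, $|X|_H$ the maximal Hausdorff quotient of $|X|$, and $\pi_H:X_0\to|X|_H$ the projection. A point $p\in|X|$ is smooth if all $\gamma\in G_x$, $\pi(x)=p$, act trivially near $x$. A wnb groupoid $(\mathcal B,\Lambda)$ is an oriented sse groupoid with trivial stabilizers and a function $\Lambda:|B|_H\to(0,\infty)$ such that every $p\in|B|_H$ has an open neighbourhood $N$, finitely many disjoint open sets $U_1,\dots,U_\ell\subset\pi_H^{-1}(N)$ and weights $m_i>0$ such that the preimage of $N$ in $|B|$ is $|U_1|\cup\dots\cup|U_\ell|$, each $\pi_H:U_i\to\pi_H(U_i)$ is a homeomorphism onto a relatively closed subset of $N$, and $\Lambda(q)=\sum_{i:\,q\in\pi_H(U_i)}m_i$ for $q\in N$.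 A smooth functor $F:\mathcal B'\to\mathcal B$ of wnb groupoids is a layered covering if it is an oriented local diffeomorphism on objects, $|B'|\to|B|$ is surjective, $|B'|_H\to|B|_H$ is proper, and the sum of $\Lambda'$ over each fibre of the latter map is the value of $\Lambda$. A smooth functor $F$ from a wnb groupoid $(\mathcal B,\Lambda)$ to an ep groupoid $\mathcal X$ is a resolution if it is an oriented local diffeomorphism on objects, the induced map $|B|_H\to|X|$ is well defined and proper, and the sum of $\Lambda$ over its fibre at each smooth point is $1$. $(\mathcal B,\Lambda)$ is commensurate with $\mathcal X$ if some wnb groupoid is both a layered covering of $(\mathcal B,\Lambda)$ and a resolution of $\mathcal X$. Let $\mathcal X$ be an oriented ep groupoid constructed from a good atlas $\mathcal A=\{(U_i,G_i)\}_{i\in A}$, $A$ linearly ordered: $X_0=\bigsqcup_i U_i$ with $U_i\subset\mathbb R^d$ open and connected, $G_i$ is a finite group acting on $U_i$, the full subcategory on $U_i$ is identified with the action groupoid $U_i\times G_i$, and the sets $|U_i|=\pi(U_i)$ form a locally finite cover of $|X|$. For nonempty finite $I=\{i_1<\dots<i_k\}\subset A$ put $|U_I|=\bigcap_{i\in I}|U_i|$,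 $G_I=\prod_{i\in I}G_i$, and let $\widehat U_I$ be the space of composable tuples $(\delta_{k-1},\dots,\delta_1)$ of morphisms with $s(\delta_j)\in U_{i_j}$ for $j<k$ and $t(\delta_{k-1})\in U_{i_k}$ (and $\widehat U_{\{i\}}=U_i$), with projection $\pi_I:\widehat U_I\to|U_I|$. For $J\subseteq I$ let $\widehat\pi_{JI}:\widehat U_I\to\widehat U_J$ omit the objects with index outside $J$ and compose the morphisms in between. Let $\mathcal V=\{|V_I|\}$ be an $\mathcal A$-compatible cover: the $|V_I|$ are open and cover $|X|$; $cl(|V_I|)\subset|U_I|$; for nonempty $|V_I|,|V_J|$ the conditions $cl(|V_I|)\cap cl(|V_J|)\neq\emptyset$, $|V_I|\cap|V_J|\ne\emptyset$, and ($I\subseteq J$ or $J\subseteq I$) are equivalent; and for $i\in I$ distinct components of $U_i\cap\pi^{-1}(|V_I|)$ have disjoint closures in $U_i$. Let $\mathcal X_{\mathcal V}$ be the topological groupoid with object space $\bigsqcup_I\widehat V_I$, $\widehat V_I=\pi_I^{-1}(|V_I|)$, with at most one morphism between two objects, whose morphisms are generated under composition and inversion by $x\to\widehat\pi_{JI}(x)$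 for $J\subseteq I$, $x\in\widehat V_I$, $\widehat\pi_{JI}(x)\in\widehat V_J$; its morphism space is a subspace of the product of two copies of the object space. **Proposition.** There are an oriented sse structure on $\mathcal X_{\mathcal V}$, a function $\Lambda_{\mathcal V}:|X_{\mathcal V}|_H\to(0,\infty)$ and a functor $F:\mathcal X_{\mathcal V}\to\mathcal X$ such that: 1. $F$ is the projection: on objects it takes a tuple to its first object $s(\delta_1)\in U_{i_1}$, and it takes the morphism $x\to\widehat\pi_{JI}(x)$, $x\in\widehat V_I$, to the composite in the tuple $x$ from its object with index $\min I$ to its object with index $\min J$. 2. $(\mathcal X_{\mathcal V},\Lambda_{\mathcal V})$ is a wnb groupoid. 3. There is a locally constant function $\kappa$ on $|X|$ with $\kappa(\pi(x))=|G_x|$ whenever $\pi(x)$ is smooth, such that $\Lambda_{\mathcal V}(p)=\kappa(w)/|G_I|$ for all $p\in|X_{\mathcal V}|_H$, where $w\in|X|$ is the image of $p$ and $I$ is the index set of minimal length with $w\in cl(|V_I|)$. 4. $F$ is a resolution of $\mathcal X$. 5. $(\mathcal X_{\mathcal V},\Lambda_{\mathcal V})$ is commensurate with $\mathcal X$. 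-/

import Mathlib

open Set Filter Topology
open scoped Manifold ContDiff

universe u

noncomputable section

namespace Orbi

/-! ### Oriented manifolds -/

/-- The (possibly nonlinear, a priori) map `A` between vector spaces is a linear isomorphism that
takes the orientation `o` to the orientation `o'`. -/
def CarriesOrientation {d : ℕ} {V W : Type*} [AddCommGroup V] [Module ℝ V] [AddCommGroup W]
    [Module ℝ W] (A : V → W) (o : Orientation ℝ V (Fin d)) (o' : Orientation ℝ W (Fin d)) : Prop :=
  ∃ e : V ≃ₗ[ℝ] W, (∀ v, e v = A v) ∧ Orientation.map (Fin d) e o = o'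

/-- The structure of an oriented smooth second countable Hausdorff `d`-manifold without boundary
on the topological space `M`: a smooth atlas, and an orientation of every tangent space that is
locally constant in charts. -/
class OrientedManifold (d : ℕ) (M : Type u) [TopologicalSpace M] extends
    ChartedSpace (EuclideanSpace ℝ (Fin d)) M where
  isManifold : IsManifold (𝓡 d) ∞ M
  t2 : T2Space M
  secondCountable : SecondCountableTopology M
  orient : ∀ x : M, Orientation ℝ (TangentSpace (𝓡 d) x) (Fin d)
  orient_locallyConstant : ∀ x : M, ∃ o : Orientation ℝ (EuclideanSpace ℝ (Fin d)) (Fin d),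
    ∀ᶠ y in 𝓝 x, CarriesOrientation
      (mfderiv (𝓡 d) (𝓡 d) (chartAt x) y :
        TangentSpace (𝓡 d) y → EuclideanSpace ℝ (Fin d)) (orient y) o

attribute [instance] OrientedManifold.isManifold OrientedManifold.t2
  OrientedManifold.secondCountable

/-- Orientation preserving local diffeomorphisms. -/
def IsOrientedLocalDiffeo (d : ℕ) {M N : Type u} [TopologicalSpace M] [TopologicalSpace N]
    [OrientedManifold d M] [OrientedManifold d N] (f : M → N) : Prop :=
  IsLocalDiffeomorph (𝓡 d) (𝓡 d) ∞ f ∧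
    ∀ x, CarriesOrientation (mfderiv (𝓡 d) (𝓡 d) f x)
      (OrientedManifold.orient x) (OrientedManifold.orient (f x))

/-! ### Topological groupoids, orbit spaces, maximal Hausdorff quotients -/

/-- A small topological groupoid with object space `Obj` and morphism space `Mor`; `comp δ γ` is
the composite `δγ` (first `γ`, then `δ`), defined when `src δ = tgt γ`. -/
structure TopGroupoid where
  Obj : Type u
  Mor : Type u
  [topObj : TopologicalSpace Obj]
  [topMor : TopologicalSpace Mor]
  src : Mor → Obj
  tgt : Mor → Obj
  one : Obj → Mor
  inv : Mor → Mor
  comp : (δ γ : Mor) → src δ = tgt γ → Mor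
  src_one : ∀ x, src (one x) = x
  tgt_one : ∀ x, tgt (one x) = x
  src_inv : ∀ γ, src (inv γ) = tgt γ
  tgt_inv : ∀ γ, tgt (inv γ) = src γ
  src_comp : ∀ δ γ h, src (comp δ γ h) = src γ
  tgt_comp : ∀ δ γ h, tgt (comp δ γ h) = tgt δ
  one_comp : ∀ γ, comp (one (tgt γ)) γ (src_one _) = γ
  comp_one : ∀ γ, comp γ (one (src γ)) (tgt_one _).symm = γ
  assoc : ∀ ε δ γ (h : src ε = tgt δ) (h' : src δ = tgt γ),
    comp (comp ε δ h) γ ((src_comp ε δ h).trans h') =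
      comp ε (comp δ γ h') (h.trans (tgt_comp δ γ h').symm)
  inv_comp : ∀ γ, comp (inv γ) γ (src_inv γ) = one (src γ)
  comp_inv : ∀ γ, comp γ (inv γ) (tgt_inv γ).symm = one (tgt γ)
  continuous_src : Continuous src
  continuous_tgt : Continuous tgt
  continuous_one : Continuous one
  continuous_inv : Continuous inv
  continuous_comp : Continuous
    (fun p : {p : Mor × Mor // src p.1 = tgt p.2} => comp p.1.1 p.1.2 p.2)

attribute [instance] TopGroupoid.topObj TopGroupoid.topMor

namespace TopGroupoid

/-- `x ∼ y` iff there is a morphism from `x` to `y`. -/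
def orbitSetoid (X : TopGroupoid.{u}) : Setoid X.Obj where
  r x y := ∃ γ, X.src γ = x ∧ X.tgt γ = y
  iseqv :=
    { refl := fun x => ⟨X.one x, X.src_one x, X.tgt_one x⟩
      symm := by
        rintro x y ⟨γ, rfl, rfl⟩
        exact ⟨X.inv γ, X.src_inv γ, X.tgt_inv γ⟩
      trans := by
        rintro x y z ⟨γ, rfl, rfl⟩ ⟨δ, h, rfl⟩
        exact ⟨X.comp δ γ h, X.src_comp δ γ h, X.tgt_comp δ γ h⟩ }

/-- The orbit space `|X|`, with the quotient topology. -/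
abbrev OrbitSpace (X : TopGroupoid.{u}) : Type u := Quotient X.orbitSetoid

/-- The projection from the objects to the orbit space. -/
def proj (X : TopGroupoid.{u}) (x : X.Obj) : X.OrbitSpace := Quotient.mk X.orbitSetoid x

/-- The maximal Hausdorff quotient of the orbit space. -/
abbrev HausdorffOrbitSpace (X : TopGroupoid.{u}) : Type u := T2Quotient X.OrbitSpace

/-- The projection from the objects to the maximal Hausdorff quotient of the orbit space. -/
def projH (X : TopGroupoid.{u}) (x : X.Obj) : X.HausdorffOrbitSpace := T2Quotient.mk (X.proj x)

/-- The stabilizer (group of self-morphisms) of an object. -/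
abbrev Stab (X : TopGroupoid.{u}) (x : X.Obj) : Type u := {γ : X.Mor // X.src γ = x ∧ X.tgt γ = x}

/-- All stabilizers are trivial. -/
def IsNonsingular (X : TopGroupoid.{u}) : Prop :=
  ∀ γ : X.Mor, X.src γ = X.tgt γ → γ = X.one (X.src γ)

/-- Properness of the map that takes a morphism to its source and target. -/
def IsProper (X : TopGroupoid.{u}) : Prop :=
  IsProperMap (fun γ : X.Mor => (X.src γ, X.tgt γ))

/-- A point `p` of the orbit space is smooth if all elements of the stabilizers of the objects
over `p` act trivially near these objects: the morphisms near a self-morphism `γ` form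
the graph of its local extension, and this is the identity iff they have the same source and
target. -/
def IsSmoothPoint (X : TopGroupoid.{u}) (p : X.OrbitSpace) : Prop :=
  ∀ x : X.Obj, X.proj x = p → ∀ γ : X.Stab x, ∀ᶠ γ' in 𝓝 γ.1, X.src γ' = X.tgt γ'

/-- The topological groupoid of an equivalence relation `r` on a space `S`: objects `S`, and exactly
one morphism from `a` to `b` if `r a b`, none otherwise; the space of morphisms is the graph of the
relation. -/
def ofSetoid (S : Type u) [TopologicalSpace S] (r : Setoid S) : TopGroupoid.{u} where
  Obj := S
  Mor := {p : S × S // r p.1 p.2}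
  src p := p.1.1
  tgt p := p.1.2
  one x := ⟨(x, x), r.refl x⟩
  inv p := ⟨(p.1.2, p.1.1), r.symm p.2⟩
  comp q p h := ⟨(p.1.1, q.1.2), r.trans p.2 (h ▸ q.2)⟩
  src_one _ := rfl
  tgt_one _ := rfl
  src_inv _ := rfl
  tgt_inv _ := rfl
  src_comp _ _ _ := rfl
  tgt_comp _ _ _ := rfl
  one_comp _ := rfl
  comp_one _ := rfl
  assoc _ _ _ _ _ := rfl
  inv_comp _ := rfl
  comp_inv _ := rfl
  continuous_src := by fun_prop
  continuous_tgt := by fun_prop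
  continuous_one := by fun_prop
  continuous_inv := by fun_prop
  continuous_comp := by fun_prop

/-- Functors between topological groupoids, on objects and on morphisms. -/
structure Hom (B X : TopGroupoid.{u}) where
  obj : B.Obj → X.Obj
  mor : B.Mor → X.Mor
  src_mor : ∀ γ, X.src (mor γ) = obj (B.src γ)
  tgt_mor : ∀ γ, X.tgt (mor γ) = obj (B.tgt γ)
  mor_one : ∀ x, mor (B.one x) = X.one (obj x)
  mor_comp : ∀ δ γ (h : B.src δ = B.tgt γ),
    mor (B.comp δ γ h) =
      X.comp (mor δ) (mor γ) ((src_mor δ).trans ((congrArg obj h).trans (tgt_mor γ).symm))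

end TopGroupoid

/-! ### Smooth, stable, étale groupoids -/

/-- The structure of an oriented sse (smooth, stable, étale) Lie groupoid of dimension `d` on the
topological groupoid `X`: objects and morphisms are oriented manifolds, the structure maps are
oriented local diffeomorphisms, and the stabilizers are finite. Composition `m` is continuous, hence
also an oriented local diffeomorphism of the fibre product (with the manifold structure that makes
its projections local diffeomorphisms), because `s ∘ m = s ∘ pr₂`. -/
class SSEStructure (d : ℕ) (X : TopGroupoid.{u}) where
  [manObj : OrientedManifold d X.Obj]
  [manMor : OrientedManifold d X.Mor]
  src_etale : IsOrientedLocalDiffeo d X.src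
  tgt_etale : IsOrientedLocalDiffeo d X.tgt
  one_etale : IsOrientedLocalDiffeo d X.one
  inv_etale : IsOrientedLocalDiffeo d X.inv
  stable : ∀ x, Finite (X.Stab x)

attribute [reducible, instance] SSEStructure.manObj SSEStructure.manMor

/-- A functor is smooth if it is smooth on objects and on morphisms. -/
def IsSmoothFunctor (d : ℕ) {B X : TopGroupoid.{u}} [SSEStructure d B] [SSEStructure d X]
    (F : B.Hom X) : Prop :=
  ContMDiff (𝓡 d) (𝓡 d) ∞ F.obj ∧ ContMDiff (𝓡 d) (𝓡 d) ∞ F.mor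

/-! ### Weighted nonsingular branched groupoids -/

/-- `(N, U, m)` is a local branching structure for the weighting `Λ` (at each point of `N`). -/
structure IsLocalBranching (B : TopGroupoid.{u}) (Λ : B.HausdorffOrbitSpace → ℝ)
    (N : Set B.HausdorffOrbitSpace) {ℓ : ℕ} (U : Fin ℓ → Set B.Obj) (m : Fin ℓ → ℝ) : Prop where
  isOpen_nhd : IsOpen N
  isOpen_branch : ∀ i, IsOpen (U i)
  branch_subset : ∀ i, U i ⊆ B.projH ⁻¹' N
  disjoint : Pairwise fun i j => Disjoint (U i) (U j)
  weight_pos : ∀ i, 0 < m i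
  covering : (T2Quotient.mk : B.OrbitSpace → B.HausdorffOrbitSpace) ⁻¹' N = ⋃ i, B.proj '' U i
  /-- The projection restricts to a homeomorphism of each branch onto its image. -/
  embedding : ∀ i, IsEmbedding ((U i).domRestrict B.projH)
  /-- The image of each branch is relatively closed in `N`. -/
  closed : ∀ i, ∃ C : Set B.HausdorffOrbitSpace, IsClosed C ∧ B.projH '' U i = C ∩ N
  weighting : ∀ q ∈ N, Λ q = ∑ i, Set.indicator (B.projH '' U i) (fun _ => m i) q

/-- `(B, Λ)` is a weighted nonsingular branched (wnb) groupoid of dimension `d`. -/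
structure IsWNB (d : ℕ) (B : TopGroupoid.{u}) [SSEStructure d B]
    (Λ : B.HausdorffOrbitSpace → ℝ) : Prop where
  nonsingular : B.IsNonsingular
  pos : ∀ p, 0 < Λ p
  branching : ∀ p, ∃ (N : Set B.HausdorffOrbitSpace) (ℓ : ℕ) (U : Fin ℓ → Set B.Obj)
    (m : Fin ℓ → ℝ), p ∈ N ∧ IsLocalBranching B Λ N U m

/-- `F : (B', Λ') → (B, Λ)` is a layered covering. The map `f` is the (unique) map induced by `F`
on the maximal Hausdorff quotients of the orbit spaces. -/
def IsLayeredCovering (d : ℕ) {B' B : TopGroupoid.{u}} [SSEStructure d B'] [SSEStructure d B]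
    (Λ' : B'.HausdorffOrbitSpace → ℝ) (Λ : B.HausdorffOrbitSpace → ℝ) (F : B'.Hom B) : Prop :=
  IsSmoothFunctor d F ∧ IsOrientedLocalDiffeo d F.obj ∧
  (∀ y : B.Obj, ∃ x : B'.Obj, B.proj (F.obj x) = B.proj y) ∧
  ∃ f : B'.HausdorffOrbitSpace → B.HausdorffOrbitSpace,
    (∀ x, f (B'.projH x) = B.projH (F.obj x)) ∧ IsProperMap f ∧
    ∀ p, HasSum (fun q : {q // f q = p} => Λ' q.1) (Λ p)

/-- `F : (B, Λ) → X` is a resolution of the proper groupoid `X`. The map `f` is the (unique) map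
from the maximal Hausdorff quotient of the orbit space of `B` to the orbit space of `X` that is
induced by `F`. -/
def IsResolution (d : ℕ) {B X : TopGroupoid.{u}} [SSEStructure d B] [SSEStructure d X]
    (Λ : B.HausdorffOrbitSpace → ℝ) (F : B.Hom X) : Prop :=
  IsSmoothFunctor d F ∧ IsOrientedLocalDiffeo d F.obj ∧
  ∃ f : B.HausdorffOrbitSpace → X.OrbitSpace,
    (∀ x, f (B.projH x) = X.proj (F.obj x)) ∧ IsProperMap f ∧
    ∀ p, X.IsSmoothPoint p → HasSum (fun q : {q // f q = p} => Λ q.1) 1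

/-- The wnb groupoid `(B, Λ)` is commensurate with the proper groupoid `X` (weighted by `1`): there
is a wnb groupoid that is a layered covering of `(B, Λ)` and a resolution of `X`. -/
def IsCommensurate (d : ℕ) (B X : TopGroupoid.{u}) [SSEStructure d B] [SSEStructure d X]
    (Λ : B.HausdorffOrbitSpace → ℝ) : Prop :=
  ∃ (C : TopGroupoid.{u}) (_ : SSEStructure d C) (ΛC : C.HausdorffOrbitSpace → ℝ)
    (P : C.Hom B) (Q : C.Hom X),
    IsWNB d C ΛC ∧ IsLayeredCovering d ΛC Λ P ∧ IsResolution d ΛC Q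

/-! ### Good atlases and compatible covers -/

/-- The groupoid `X` is constructed from a good atlas with linearly ordered index set `ι`: the
object space is the disjoint union of charts `Uᵢ`, each identified with a connected open subset
of `ℝ^d`; the full subcategory on `Uᵢ` is identified with the action groupoid `Gᵢ × Uᵢ` of a finite
group `Gᵢ`; and the images `|Uᵢ|` form a locally finite cover of the orbit space. (Since `X` is an
oriented étale groupoid, the groups then act by orientation preserving diffeomorphisms.) -/
structure GoodAtlas (d : ℕ) (X : TopGroupoid.{u}) [SSEStructure d X] (ι : Type u) where
  chart : ι → OpenPartialHomeomorph X.Obj (EuclideanSpace ℝ (Fin d))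
  chart_mem : ∀ i, chart i ∈ IsManifold.maximalAtlas (𝓡 d) ∞ X.Obj
  connected : ∀ i, IsConnected (chart i).target
  disjoint : Pairwise fun i j => Disjoint (chart i).source (chart j).source
  cover : ⋃ i, (chart i).source = univ
  G : ι → Type u
  [group : ∀ i, Group (G i)]
  [finite : ∀ i, Finite (G i)]
  [action : ∀ i, MulAction (G i) (chart i).source]
  /-- `emb i g x` is the morphism from `x` to `g • x` given by `g ∈ Gᵢ`. -/
  emb : ∀ i, G i → (chart i).source → X.Mor
  src_emb : ∀ i g x, X.src (emb i g x) = x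
  tgt_emb : ∀ i g x, X.tgt (emb i g x) = (g • x : (chart i).source)
  emb_one : ∀ i x, emb i 1 x = X.one x
  emb_mul : ∀ i g h x, emb i (g * h) x =
    X.comp (emb i g (h • x)) (emb i h x) ((src_emb i g (h • x)).trans (tgt_emb i h x).symm)
  emb_bijective : ∀ i γ, X.src γ ∈ (chart i).source → X.tgt γ ∈ (chart i).source →
    ∃! p : G i × (chart i).source, emb i p.1 p.2 = γ
  continuous_emb : ∀ i g, Continuous (emb i g)
  locallyFinite : LocallyFinite fun i => X.proj '' (chart i).source

attribute [instance] GoodAtlas.group GoodAtlas.finite GoodAtlas.action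

/-- The nonempty finite subsets of the index set of an atlas. -/
abbrev IndexSet (ι : Type u) : Type u := {I : Finset ι // I.Nonempty}

/-- The smallest element of `I`. -/
def IndexSet.first {ι : Type u} [LinearOrder ι] (I : IndexSet ι) : I.1 :=
  ⟨I.1.min' I.2, I.1.min'_mem I.2⟩

theorem IndexSet.first_le {ι : Type u} [LinearOrder ι] (I : IndexSet ι) (i : I.1) :
    I.first ≤ i := I.1.min'_le i.1 i.2

section Atlas

variable {d : ℕ} {X : TopGroupoid.{u}} [SSEStructure d X] {ι : Type u}

/-- The chart domain `Uᵢ` as a subset of the object space. -/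
def GoodAtlas.dom (A : GoodAtlas d X ι) (i : ι) : Set X.Obj := (A.chart i).source

/-- The image `|Uᵢ|` of a chart in the orbit space. -/
def GoodAtlas.cell (A : GoodAtlas d X ι) (i : ι) : Set X.OrbitSpace := X.proj '' A.dom i

/-- The order of the group `G_I`, the product of the groups `Gᵢ`, `i ∈ I`. -/
def GoodAtlas.groupCard (A : GoodAtlas d X ι) (I : IndexSet ι) : ℕ :=
  Nat.card (∀ i : I.1, A.G i)

/-- A cover of the orbit space by open sets `|V_I|` that is compatible with the atlas. Index sets
`I` with empty `|V_I|` are allowed and do not count as members of the cover. -/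
structure CompatibleCover (A : GoodAtlas d X ι) where
  V : IndexSet ι → Set X.OrbitSpace
  isOpen : ∀ I, IsOpen (V I)
  cover : ⋃ I, V I = univ
  closure_subset : ∀ I, closure (V I) ⊆ ⋂ i ∈ I.1, A.cell i
  closure_inter_iff : ∀ I J, (V I).Nonempty → (V J).Nonempty →
    ((closure (V I) ∩ closure (V J)).Nonempty ↔ (V I ∩ V J).Nonempty)
  inter_iff : ∀ I J, (V I).Nonempty → (V J).Nonempty →
    ((V I ∩ V J).Nonempty ↔ (I.1 ⊆ J.1 ∨ J.1 ⊆ I.1))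
  /-- Distinct components of the preimage of `|V_I|` in `Uᵢ` have disjoint closures in `Uᵢ`. -/
  components : ∀ I : IndexSet ι, ∀ i ∈ I.1,
    ∀ x ∈ A.dom i ∩ X.proj ⁻¹' V I, ∀ y ∈ A.dom i ∩ X.proj ⁻¹' V I,
      connectedComponentIn (A.dom i ∩ X.proj ⁻¹' V I) x ≠
        connectedComponentIn (A.dom i ∩ X.proj ⁻¹' V I) y →
      Disjoint (closure (connectedComponentIn (A.dom i ∩ X.proj ⁻¹' V I) x) ∩ A.dom i)
        (closure (connectedComponentIn (A.dom i ∩ X.proj ⁻¹' V I) y) ∩ A.dom i)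

/-! ### The groupoid associated with a compatible cover -/

variable [LinearOrder ι]

/-- A composable tuple `x_{i₁} → x_{i₂} → ⋯ → x_{iₖ}` of morphisms with `x_i ∈ U_i`, where
`I = {i₁ < ⋯ < iₖ}`. The tuple is recorded together with its objects (so that for `I = {i}` it is
just a point of `Uᵢ`) and with its partial composites, that is as a functor from the chain `I`
to `X`; it is determined by its first object and the morphisms between consecutive objects. -/
structure Tuple (A : GoodAtlas d X ι) (I : IndexSet ι) where
  obj : I.1 → X.Obj
  hom : {p : I.1 × I.1 // p.1 ≤ p.2} → X.Mor
  obj_mem : ∀ i : I.1, obj i ∈ A.dom i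
  src_hom : ∀ p, X.src (hom p) = obj p.1.1
  tgt_hom : ∀ p, X.tgt (hom p) = obj p.1.2
  hom_refl : ∀ i : I.1, hom ⟨(i, i), le_refl i⟩ = X.one (obj i)
  hom_trans : ∀ (i j k : I.1) (hij : i ≤ j) (hjk : j ≤ k),
    hom ⟨(i, k), hij.trans hjk⟩ = X.comp (hom ⟨(j, k), hjk⟩) (hom ⟨(i, j), hij⟩)
      ((src_hom ⟨(j, k), hjk⟩).trans (tgt_hom ⟨(i, j), hij⟩).symm)

/-- The space of tuples is topologized as a subspace of a product of copies of the object and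
morphism spaces of `X`. -/
instance (A : GoodAtlas d X ι) (I : IndexSet ι) : TopologicalSpace (Tuple A I) :=
  TopologicalSpace.induced (fun x => (x.obj, x.hom)) inferInstance

/-- The projection from tuples indexed by `I` to tuples indexed by `J ⊆ I`: it omits the
objects with index outside `J` and composes the morphisms in between. -/
def Tuple.restrict {A : GoodAtlas d X ι} {I J : IndexSet ι} (h : J.1 ⊆ I.1) (x : Tuple A I) :
    Tuple A J where
  obj j := x.obj ⟨j.1, h j.2⟩
  hom p := x.hom ⟨(⟨p.1.1.1, h p.1.1.2⟩, ⟨p.1.2.1, h p.1.2.2⟩), p.2⟩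
  obj_mem j := x.obj_mem ⟨j.1, h j.2⟩
  src_hom _ := x.src_hom _
  tgt_hom _ := x.tgt_hom _
  hom_refl _ := x.hom_refl _
  hom_trans _ _ _ hij hjk := x.hom_trans _ _ _ hij hjk

/-- The projection from tuples to the orbit space of `X`; all objects of a tuple have the
same image. -/
def Tuple.proj {A : GoodAtlas d X ι} {I : IndexSet ι} (x : Tuple A I) : X.OrbitSpace :=
  X.proj (x.obj I.first)

namespace CompatibleCover

variable {A : GoodAtlas d X ι}

/-- The objects: the disjoint union over `I` of the spaces of tuples that lie over `|V_I|`. -/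
abbrev TupleObj (𝒱 : CompatibleCover A) : Type u :=
  Σ I : IndexSet ι, {x : Tuple A I // x.proj ∈ 𝒱.V I}

/-- There is a basic morphism from `a` (over `|V_I|`) to `b` (over `|V_J|`) if `J ⊆ I` and the
projection from `I`-tuples to `J`-tuples takes `a` to `b`. -/
def Step (𝒱 : CompatibleCover A) (a b : 𝒱.TupleObj) : Prop :=
  ∃ h : b.1.1 ⊆ a.1.1, a.2.1.restrict h = b.2.1

/-- The groupoid of the cover: its objects are the tuples, its morphisms are generated under
composition and inversion by the projections, with at most one morphism between two objects. -/
def groupoid (𝒱 : CompatibleCover A) : TopGroupoid.{u} :=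
  TopGroupoid.ofSetoid 𝒱.TupleObj (Relation.EqvGen.setoid 𝒱.Step)

/-- The basic morphism from `a` to `b` given by a projection. -/
def stepMor (𝒱 : CompatibleCover A) (a b : 𝒱.TupleObj) (h : 𝒱.Step a b) : 𝒱.groupoid.Mor :=
  ⟨(a, b), Relation.EqvGen.rel a b h⟩

/-- `I` is the index set of minimal length with `w` in the closure of `|V_I|`. -/
def IsMinIndex (𝒱 : CompatibleCover A) (w : X.OrbitSpace) (I : IndexSet ι) : Prop :=
  w ∈ closure (𝒱.V I) ∧ ∀ J, w ∈ closure (𝒱.V J) → I.1.card ≤ J.1.card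

/-- `F` is the projection of the groupoid of the cover to `X`: a tuple goes to its first object, and
the basic morphism given by the projection from `I`-tuples to `J`-tuples, with source the tuple `a`,
goes to the composite of the morphisms in `a` from index `min I` to index `min J`. -/
def IsProjection (𝒱 : CompatibleCover A) (F : 𝒱.groupoid.Hom X) : Prop :=
  (∀ a : 𝒱.TupleObj, F.obj a = a.2.1.obj a.1.first) ∧
  ∀ (a b : 𝒱.TupleObj) (h : 𝒱.Step a b),
    F.mor (𝒱.stepMor a b h) =
      a.2.1.hom ⟨(a.1.first, ⟨b.1.first.1, h.1 b.1.first.2⟩), a.1.first_le _⟩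

end CompatibleCover

end Atlas

end Orbi

end

namespace Orbi

/-! ### Oriented local diffeomorphisms -/

/-! Compatibility of the cover makes the index sets I with w ∈ cl|V_I| a finite chain under
inclusion. So each w ∈ |X| has a smallest I with w ∈ |V_I| (`low`) and a smallest I with w ∈ cl|V_I|
(`clow`). Two tuples over w are joined by a morphism iff their restrictions to `low w` agree
(`eqvGen_iff`), and they have the same image in the maximal Hausdorff quotient iff their
restrictions to `clow w` agree (`projH_eq_iff`). In the second equivalence, tuples that agree on
`clow w` are limits of pairs of equivalent tuples over |V_I|, I = `clow w`. Conversely, agreement on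
`clow` has a Hausdorff quotient, because `clow` can only grow near w.

A tuple is the same as a family of morphisms out of any one of its objects. As X is étale, each
object of a tuple is a local coordinate, so the restriction maps are local homeomorphisms and the
new groupoid is étale. Its oriented smooth structure is pulled back from X along the first object.
The projection sends a morphism a → b to the morphism of X that passes through an object shared by
the two tuples.

The weights come from counting morphisms. From a point x over |U_i| there are |G_i| morphisms into
U_i. Hence |G_I| is |G_x| times the number of I-tuples over π(x) (`card_proj_fibre`), and |G_I| is
|G_J| times the number of I-tuples that restrict to a given J-tuple (`card_restrict_fibre`). Let κ
count the stabilizer elements acting trivially near the point. It is locally constant, because an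
element of G_i that is trivial near one point of the connected chart U_i is trivial on U_i
(`smul_eq_of_eventually`).

Near w ∈ |V_I| the finitely many I-tuples over w spread to disjoint sheets, and these are the
branches, each of weight κ/|G_I|. A point q over w' lies in |G_I|/|G_K| of them, K = `clow w'`,
which gives total weight κ/|G_K|. Over a smooth point with K = `clow w`, the |G_K|/|G_x| points of
the fibre have weight |G_x|/|G_K| each, so the sum is 1. Commensurability follows with the identity
as layered covering. -/

theorem CarriesOrientation.comp {d : ℕ} {U V W : Type*} [AddCommGroup U] [Module ℝ U]
    [AddCommGroup V] [Module ℝ V] [AddCommGroup W] [Module ℝ W] {A : U → V} {B : V → W}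
    {o : Orientation ℝ U (Fin d)} {o' : Orientation ℝ V (Fin d)} {o'' : Orientation ℝ W (Fin d)}
    (hB : CarriesOrientation B o' o'') (hA : CarriesOrientation A o o') :
    CarriesOrientation (B ∘ A) o o'' := by
  obtain ⟨e, he, rfl⟩ := hA
  obtain ⟨e', he', rfl⟩ := hB
  refine ⟨e.trans e', fun v => by simp [he, he'], ?_⟩
  induction o using Module.Ray.ind with
  | h v hv => simp [Orientation.map_apply]; rfl

theorem CarriesOrientation.symm {d : ℕ} {V W : Type*} [AddCommGroup V] [Module ℝ V]
    [AddCommGroup W] [Module ℝ W] {A : V → W} {B : W → V}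
    {o : Orientation ℝ V (Fin d)} {o' : Orientation ℝ W (Fin d)}
    (hA : CarriesOrientation A o o') (h : ∀ v, B (A v) = v) : CarriesOrientation B o' o := by
  obtain ⟨e, he, rfl⟩ := hA
  refine ⟨e.symm, fun v => ?_, ?_⟩
  · obtain ⟨w, rfl⟩ := e.surjective v
    rw [e.symm_apply_apply, he, h]
  · rw [← Orientation.map_symm, Equiv.symm_apply_apply]

theorem CarriesOrientation.of_comp {d : ℕ} {U V W : Type*} [AddCommGroup U] [Module ℝ U]
    [AddCommGroup V] [Module ℝ V] [AddCommGroup W] [Module ℝ W] {A : U → V} {B : V → W}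
    {o : Orientation ℝ U (Fin d)} {o' : Orientation ℝ V (Fin d)} {o'' : Orientation ℝ W (Fin d)}
    (hB : CarriesOrientation B o' o'') (hBA : CarriesOrientation (B ∘ A) o o'') :
    CarriesOrientation A o o' := by
  obtain ⟨e, he, rfl⟩ := hB
  have h2 : CarriesOrientation e.symm (Orientation.map (Fin d) e o') o' :=
    CarriesOrientation.symm (A := e) ⟨e, fun _ => rfl, rfl⟩ e.symm_apply_apply
  convert h2.comp hBA using 1
  ext v
  simp [← he]

theorem CarriesOrientation.id {d : ℕ} {V : Type*} [AddCommGroup V] [Module ℝ V]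
    (o : Orientation ℝ V (Fin d)) : CarriesOrientation (fun v : V => v) o o :=
  ⟨LinearEquiv.refl ℝ V, fun _ => rfl, by simp⟩

/-! ### Cancellation for local diffeomorphisms -/

section LocalDiffeo

variable {E F G H H' H'' : Type*} [NormedAddCommGroup E] [NormedSpace ℝ E]
  [NormedAddCommGroup F] [NormedSpace ℝ F] [NormedAddCommGroup G] [NormedSpace ℝ G]
  [TopologicalSpace H] [TopologicalSpace H'] [TopologicalSpace H'']
  {I : ModelWithCorners ℝ E H} {J : ModelWithCorners ℝ F H'} {K : ModelWithCorners ℝ G H''}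
  {M N P : Type*} [TopologicalSpace M] [ChartedSpace H M] [TopologicalSpace N] [ChartedSpace H' N]
  [TopologicalSpace P] [ChartedSpace H'' P] {n : WithTop ℕ∞}

/-- An open partial homeomorphism that is smooth in both directions. -/
def partialDiffeoOfContMDiffOn (e : OpenPartialHomeomorph M N) (h : ContMDiffOn I J n e e.source)
    (h' : ContMDiffOn J I n e.symm e.target) : PartialDiffeomorph I J M N n where
  toPartialEquiv := e.toPartialEquiv
  open_source := e.open_source
  open_target := e.open_target
  contMDiffOn_toFun := h
  contMDiffOn_invFun := h'

theorem isLocalDiffeomorphAt_congr {f g : M → N} {x : M} (hf : IsLocalDiffeomorphAt I J n f x)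
    (h : g =ᶠ[𝓝 x] f) : IsLocalDiffeomorphAt I J n g x := by
  obtain ⟨Φ, hx, hΦ⟩ := hf
  obtain ⟨s, hs, hso, hxs⟩ := eventually_nhds_iff.1 h
  refine ⟨partialDiffeoOfContMDiffOn (Φ.toOpenPartialHomeomorph.restrOpen s hso)
    (Φ.contMDiffOn_toFun.mono inter_subset_left) (Φ.contMDiffOn_invFun.mono inter_subset_left),
    ⟨hx, hxs⟩, fun y hy => ?_⟩
  rw [hs y hy.2]
  exact hΦ hy.1

/-- Near x, f is g ∘ f followed by the local inverse of g; continuity of f keeps nearby values in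
the region where that inverse is valid. -/
theorem isLocalDiffeomorphAt_of_comp {f : M → N} {g : N → P} {x : M}
    (hg : IsLocalDiffeomorphAt J K n g (f x)) (hgf : IsLocalDiffeomorphAt I K n (g ∘ f) x)
    (hf : ContinuousAt f x) : IsLocalDiffeomorphAt I J n f x := by
  refine isLocalDiffeomorphAt_congr (IsLocalDiffeomorphAt.comp (hf := hgf)
    (hg := hg.localInverse_isLocalDiffeomorphAt)) ?_
  filter_upwards [hf.eventually hg.localInverse_eventuallyEq_left] with y hy
  exact hy.symm

end LocalDiffeo

section

variable {d : ℕ} {M N P : Type u} [TopologicalSpace M] [TopologicalSpace N] [TopologicalSpace P]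

theorem IsOrientedLocalDiffeo.comp [OrientedManifold d M] [OrientedManifold d N]
    [OrientedManifold d P] {f : M → N} {g : N → P} (hg : IsOrientedLocalDiffeo d g)
    (hf : IsOrientedLocalDiffeo d f) : IsOrientedLocalDiffeo d (g ∘ f) := by
  refine ⟨fun x => IsLocalDiffeomorphAt.comp (hf := hf.1 x) (hg := hg.1 (f x)), fun x => ?_⟩
  rw [mfderiv_comp x ((hg.1 (f x)).mdifferentiableAt (by simp))
    ((hf.1 x).mdifferentiableAt (by simp))]
  exact (hg.2 (f x)).comp (hf.2 x)

/-- This cancellation makes the structure maps of the new groupoid oriented local diffeomorphisms: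
each is compared with known ones in X. -/
theorem IsOrientedLocalDiffeo.of_comp [OrientedManifold d M] [OrientedManifold d N]
    [OrientedManifold d P] {f : M → N} {g : N → P} (hg : IsOrientedLocalDiffeo d g)
    (hgf : IsOrientedLocalDiffeo d (g ∘ f)) (hf : Continuous f) : IsOrientedLocalDiffeo d f := by
  have h1 : IsLocalDiffeomorph (𝓡 d) (𝓡 d) ∞ f := fun x =>
    isLocalDiffeomorphAt_of_comp (hg.1 (f x)) (hgf.1 x) hf.continuousAt
  refine ⟨h1, fun x => ?_⟩
  have := hgf.2 x
  rw [mfderiv_comp x ((hg.1 (f x)).mdifferentiableAt (by simp))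
    ((h1 x).mdifferentiableAt (by simp))] at this
  exact (hg.2 (f x)).of_comp this

theorem isOrientedLocalDiffeo_id [OrientedManifold d M] :
    IsOrientedLocalDiffeo d (fun x : M => x) := by
  refine ⟨fun x => (Diffeomorph.refl (𝓡 d) M ∞).isLocalDiffeomorph x, fun x => ?_⟩
  have : mfderiv (𝓡 d) (𝓡 d) (fun x : M => x) x = ContinuousLinearMap.id ℝ _ := mfderiv_id
  rw [this]
  exact CarriesOrientation.id _

theorem IsOrientedLocalDiffeo.isLocalHomeomorph [OrientedManifold d M] [OrientedManifold d N]
    {f : M → N} (hf : IsOrientedLocalDiffeo d f) : IsLocalHomeomorph f :=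
  hf.1.isLocalHomeomorph

end

/-! ### Pulling back manifold structures along local homeomorphisms -/

section Pullback

variable {d : ℕ} {M N : Type u} [TopologicalSpace M] [TopologicalSpace N]

/-- Both E and E' are restrictions of p, so p cancels and the transition map is a restriction of c'
∘ c⁻¹. -/
theorem transition_mem_contDiffGroupoid [ChartedSpace (EuclideanSpace ℝ (Fin d)) N]
    [IsManifold (𝓡 d) ∞ N] {p : M → N}
    {E E' : OpenPartialHomeomorph M N} (hE : EqOn p E E.source) (hE' : EqOn p E' E'.source)
    {c c' : OpenPartialHomeomorph N (EuclideanSpace ℝ (Fin d))}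
    (hc : c ∈ atlas (EuclideanSpace ℝ (Fin d)) N) (hc' : c' ∈ atlas (EuclideanSpace ℝ (Fin d)) N) :
    (E.trans c).symm.trans (E'.trans c') ∈ contDiffGroupoid ∞ (𝓡 d) := by
  set T := (E.trans c).symm.trans (E'.trans c') with hT
  have key : ∀ u ∈ T.source, E' (E.symm (c.symm u)) = c.symm u := by
    intro u hu
    simp only [hT, mfld_simps] at hu
    rw [← hE' hu.2.1, hE (E.map_target hu.1.2), E.right_inv hu.1.2]
  have h1 : (c.symm.trans c').restr T.source ∈ contDiffGroupoid ∞ (𝓡 d) :=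
    closedUnderRestriction' (HasGroupoid.compatible hc hc') T.open_source
  refine (contDiffGroupoid ∞ (𝓡 d)).mem_of_eqOnSource h1 ⟨?_, ?_⟩
  · rw [OpenPartialHomeomorph.restr_source, T.open_source.interior_eq]
    refine (inter_eq_right.2 fun u hu => ?_).symm
    have h2 := key u hu
    simp only [hT, mfld_simps] at hu h2 ⊢
    exact ⟨hu.1.1, h2 ▸ hu.2.2⟩
  · intro u hu
    have h2 := key u hu
    simp only [hT, mfld_simps] at h2 ⊢
    rw [h2]

/-- The charts of the source of a local homeomorphism into a charted space. -/
@[reducible] noncomputable def pullbackChartedSpace [ChartedSpace (EuclideanSpace ℝ (Fin d)) N] {p : M → N}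
    (hp : IsLocalHomeomorph p) : ChartedSpace (EuclideanSpace ℝ (Fin d)) M where
  atlas := range fun x => (hp x).choose.trans (chartAt _ (p x))
  chartAt x := (hp x).choose.trans (chartAt _ (p x))
  mem_chart_source x := by
    have h : p x = (hp x).choose x := congrFun (hp x).choose_spec.2 x
    rw [OpenPartialHomeomorph.trans_source]
    refine ⟨(hp x).choose_spec.1, ?_⟩
    rw [mem_preimage, ← h]
    exact mem_chart_source _ (p x)
  chart_mem_atlas x := mem_range_self x

theorem pullback_isManifold [ChartedSpace (EuclideanSpace ℝ (Fin d)) N] [IsManifold (𝓡 d) ∞ N]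
    {p : M → N} (hp : IsLocalHomeomorph p) :
    @IsManifold ℝ _ _ _ _ _ _ (𝓡 d) ∞ M _ (pullbackChartedSpace hp) := by
  let := pullbackChartedSpace (d := d) hp
  refine @IsManifold.mk ℝ _ _ _ _ _ _ (𝓡 d) ∞ M _ _ ⟨?_⟩
  rintro _ _ ⟨x, rfl⟩ ⟨y, rfl⟩
  exact transition_mem_contDiffGroupoid (d := d) (p := p)
    (fun z _ => congrFun (hp x).choose_spec.2 z) (fun z _ => congrFun (hp y).choose_spec.2 z)
    (chart_mem_atlas _ _) (chart_mem_atlas _ _)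

theorem pullback_isLocalDiffeomorph [ChartedSpace (EuclideanSpace ℝ (Fin d)) N]
    [IsManifold (𝓡 d) ∞ N] {p : M → N} (hp : IsLocalHomeomorph p) :
    @IsLocalDiffeomorph ℝ _ _ _ _ _ _ _ _ _ _ _ (𝓡 d) (𝓡 d) M _ (pullbackChartedSpace hp) N _ _ ∞
      p := by
  let := pullbackChartedSpace (d := d) hp
  have := pullback_isManifold (d := d) hp
  intro x
  obtain ⟨hx, hE⟩ := (hp x).choose_spec
  set E := (hp x).choose with hEdef
  have hE : EqOn p E E.source := fun z _ => congrFun hE z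
  -- E followed by any chart of N is compatible with the pulled-back atlas, so E and its inverse can
  -- be tested in such charts, where they become a chart of N and its inverse.
  have key : ∀ y : N, E.trans (chartAt _ y) ∈ IsManifold.maximalAtlas (𝓡 d) ∞ M := by
    intro y
    rw [IsManifold.mem_maximalAtlas_iff, mem_maximalAtlas_iff]
    rintro _ ⟨x', rfl⟩
    exact ⟨transition_mem_contDiffGroupoid (d := d) (p := p) hE
      (fun z _ => congrFun (hp x').choose_spec.2 z) (chart_mem_atlas _ _) (chart_mem_atlas _ _),
      transition_mem_contDiffGroupoid (d := d) (p := p) (fun z _ => congrFun (hp x').choose_spec.2 z)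
        hE (chart_mem_atlas _ _) (chart_mem_atlas _ _)⟩
  refine ⟨partialDiffeoOfContMDiffOn E (fun y hy => ?_) (fun y hy => ?_), hx, hE⟩
  · have h1 := contMDiffAt_of_mem_maximalAtlas (key (E y)) (x := y) (by simp [hy])
    have h2 := contMDiffOn_chart_symm (I := 𝓡 d) (n := ∞) (x := E y) |>.contMDiffAt
      ((chartAt (EuclideanSpace ℝ (Fin d)) (E y)).open_target.mem_nhds (mem_chart_target _ (E y)))
    refine ContMDiffAt.contMDiffWithinAt ((ContMDiffAt.comp y h2 h1).congr_of_eventuallyEq ?_)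
    filter_upwards [(E.trans (chartAt (EuclideanSpace ℝ (Fin d)) (E y))).open_source.mem_nhds
      (show y ∈ _ by simp [hy])] with z hz
    simp only [mfld_simps] at hz ⊢
    simp [hz.2]
  · have h1 := contMDiffAt_symm_of_mem_maximalAtlas (key y)
      (x := chartAt (EuclideanSpace ℝ (Fin d)) y y) (by simp [hy])
    have h2 := contMDiffAt_of_mem_maximalAtlas (I := 𝓡 d) (n := ∞)
      (IsManifold.chart_mem_maximalAtlas y) (mem_chart_source (EuclideanSpace ℝ (Fin d)) y)
    refine ContMDiffAt.contMDiffWithinAt ((ContMDiffAt.comp y h1 h2).congr_of_eventuallyEq ?_)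
    filter_upwards [(chart_source_mem_nhds (EuclideanSpace ℝ (Fin d)) y)] with z hz
    simp [hz]

/-- The oriented manifold structure that makes a local homeomorphism an oriented local
diffeomorphism. -/
@[reducible] noncomputable def OrientedManifold.pullback [OrientedManifold d N] {p : M → N}
    (hp : IsLocalHomeomorph p)
    (hM : T2Space M) (hM' : SecondCountableTopology M) : OrientedManifold d M :=
  letI := pullbackChartedSpace (d := d) hp
  { isManifold := pullback_isManifold hp
    t2 := hM
    secondCountable := hM'
    orient := fun x => Orientation.map (Fin d)
      ((pullback_isLocalDiffeomorph (d := d) hp).mfderivToContinuousLinearEquiv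
        (by simp) x).symm.toLinearEquiv (OrientedManifold.orient (p x))
    orient_locallyConstant := fun x => by
      have := pullback_isManifold (d := d) hp
      obtain ⟨o, ho⟩ := OrientedManifold.orient_locallyConstant (d := d) (p x)
      refine ⟨o, ?_⟩
      filter_upwards [hp.continuous.continuousAt.eventually ho,
        hp.continuous.continuousAt.eventually
          (chart_source_mem_nhds (EuclideanSpace ℝ (Fin d)) (p x))] with y hy hy'
      have hE : p = (hp x).choose := (hp x).choose_spec.2
      have h1 : (chartAt (EuclideanSpace ℝ (Fin d)) x : M → EuclideanSpace ℝ (Fin d)) =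
          (chartAt (EuclideanSpace ℝ (Fin d)) (p x)) ∘ p := by
        change (chartAt _ (p x)) ∘ (hp x).choose = _
        rw [← hE]
      have h2 : MDifferentiableAt (𝓡 d) (𝓡 d) (chartAt (EuclideanSpace ℝ (Fin d)) (p x)) (p y) :=
        (contMDiffAt_of_mem_maximalAtlas (I := 𝓡 d) (n := ∞)
          (IsManifold.chart_mem_maximalAtlas (p x)) hy').mdifferentiableAt (by simp)
      have h3 := (pullback_isLocalDiffeomorph (d := d) hp y).mdifferentiableAt (by simp)
      rw [h1, mfderiv_comp y h2 h3]
      refine hy.comp (CarriesOrientation.symm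
        (A := ((pullback_isLocalDiffeomorph (d := d) hp).mfderivToContinuousLinearEquiv
        (by simp) y).symm) ⟨_, fun v => rfl, rfl⟩ fun v => ?_)
      exact ((pullback_isLocalDiffeomorph (d := d) hp).mfderivToContinuousLinearEquiv
        (by simp) y).apply_symm_apply v }

theorem OrientedManifold.pullback_isOrientedLocalDiffeo [OrientedManifold d N] {p : M → N}
    (hp : IsLocalHomeomorph p) (hM : T2Space M) (hM' : SecondCountableTopology M) :
    @IsOrientedLocalDiffeo d M N _ _ (OrientedManifold.pullback hp hM hM') _ p := by
  let := OrientedManifold.pullback (d := d) hp hM hM'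
  refine ⟨pullback_isLocalDiffeomorph hp, fun x => CarriesOrientation.symm
        (A := ((pullback_isLocalDiffeomorph (d := d) hp).mfderivToContinuousLinearEquiv
        (by simp) x).symm) ⟨_, fun v => rfl, rfl⟩ fun v => ?_⟩
  exact ((pullback_isLocalDiffeomorph (d := d) hp).mfderivToContinuousLinearEquiv
        (by simp) x).apply_symm_apply v

end Pullback

end Orbi

namespace Orbi

/-! ### Computations in groupoids -/

namespace TopGroupoid

variable (X : TopGroupoid.{u})

theorem comp_congr {δ δ' γ γ' : X.Mor} (h : X.src δ = X.tgt γ) (hδ : δ = δ') (hγ : γ = γ') :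
    X.comp δ γ h = X.comp δ' γ' (hδ ▸ hγ ▸ h) := by
  subst hδ hγ; rfl

theorem one_comp' {γ : X.Mor} {x : X.Obj} (h : X.src (X.one x) = X.tgt γ) :
    X.comp (X.one x) γ h = γ := by
  obtain rfl : x = X.tgt γ := (X.src_one x).symm.trans h
  exact X.one_comp γ

theorem comp_one' {γ : X.Mor} {x : X.Obj} (h : X.src γ = X.tgt (X.one x)) :
    X.comp γ (X.one x) h = γ := by
  obtain rfl : x = X.src γ := (X.tgt_one x).symm.trans h.symm
  exact X.comp_one γ

theorem inv_comp_comp {δ γ : X.Mor} (h : X.src δ = X.tgt γ) :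
    X.comp (X.inv δ) (X.comp δ γ h) ((X.src_inv δ).trans (X.tgt_comp δ γ h).symm) = γ := by
  rw [← X.assoc _ _ _ (X.src_inv δ) h, X.comp_congr _ (X.inv_comp δ) rfl, X.one_comp']

theorem comp_comp_inv {δ γ : X.Mor} (h : X.src δ = X.tgt γ) :
    X.comp (X.comp δ γ h) (X.inv γ) ((X.src_comp δ γ h).trans (X.tgt_inv γ).symm) = δ := by
  rw [X.assoc _ _ _ h (X.tgt_inv γ).symm, X.comp_congr _ rfl (X.comp_inv γ), X.comp_one']

theorem comp_left_cancel {δ γ γ' : X.Mor} {h : X.src δ = X.tgt γ} {h' : X.src δ = X.tgt γ'}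
    (H : X.comp δ γ h = X.comp δ γ' h') : γ = γ' := by
  rw [← X.inv_comp_comp h, X.comp_congr _ rfl H, X.inv_comp_comp]

theorem comp_right_cancel {δ δ' γ : X.Mor} {h : X.src δ = X.tgt γ} {h' : X.src δ' = X.tgt γ}
    (H : X.comp δ γ h = X.comp δ' γ h') : δ = δ' := by
  rw [← X.comp_comp_inv h, X.comp_congr _ H rfl, X.comp_comp_inv]

theorem inv_inv (γ : X.Mor) : X.inv (X.inv γ) = γ := by
  refine X.comp_right_cancel (γ := X.inv γ) (h := X.src_inv _) (h' := (X.tgt_inv γ).symm) ?_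
  rw [X.inv_comp, X.comp_inv, X.src_inv]

theorem inv_one (x : X.Obj) : X.inv (X.one x) = X.one x := by
  have := X.inv_comp (X.one x)
  rwa [X.comp_one', X.src_one] at this

/-- The composite `δ γ⁻¹` of two morphisms with the same source. -/
def div (δ γ : X.Mor) (h : X.src δ = X.src γ) : X.Mor :=
  X.comp δ (X.inv γ) (h.trans (X.tgt_inv γ).symm)

variable {X}

@[simp] theorem src_div {δ γ : X.Mor} (h : X.src δ = X.src γ) : X.src (X.div δ γ h) = X.tgt γ :=
  (X.src_comp _ _ _).trans (X.src_inv γ)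

@[simp] theorem tgt_div {δ γ : X.Mor} (h : X.src δ = X.src γ) : X.tgt (X.div δ γ h) = X.tgt δ :=
  X.tgt_comp _ _ _

theorem div_congr {δ δ' γ γ' : X.Mor} (h : X.src δ = X.src γ) (hδ : δ = δ') (hγ : γ = γ') :
    X.div δ γ h = X.div δ' γ' (hδ ▸ hγ ▸ h) := by
  subst hδ hγ; rfl

theorem div_same (γ : X.Mor) : X.div γ γ rfl = X.one (X.tgt γ) := X.comp_inv γ

theorem div_comp {δ γ : X.Mor} (h : X.src δ = X.src γ) :
    X.comp (X.div δ γ h) γ (src_div h) = δ := by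
  have h1 := X.comp_comp_inv (h.trans (X.tgt_inv γ).symm)
  rw [X.comp_congr _ rfl (X.inv_inv γ)] at h1
  exact h1

theorem comp_div {δ γ : X.Mor} (h : X.src δ = X.tgt γ) :
    X.div (X.comp δ γ h) γ (X.src_comp δ γ h) = δ := X.comp_comp_inv h

theorem eq_div_of_comp_eq {δ γ ε : X.Mor} {h : X.src δ = X.tgt γ} (H : X.comp δ γ h = ε) :
    δ = X.div ε γ (H ▸ X.src_comp δ γ h) := by
  subst H; exact (comp_div h).symm

theorem div_comp_div {δ γ ε : X.Mor} (h : X.src δ = X.src γ) (h' : X.src γ = X.src ε)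
    (H : X.src (X.div δ γ h) = X.tgt (X.div γ ε h')) :
    X.comp (X.div δ γ h) (X.div γ ε h') H = X.div δ ε (h.trans h') := by
  refine eq_div_of_comp_eq (h := (X.src_comp _ _ _).trans (src_div h')) ?_
  rw [X.assoc _ _ _ H (src_div h'), X.comp_congr _ rfl (div_comp h'), div_comp]

theorem inv_div {δ γ : X.Mor} (h : X.src δ = X.src γ) :
    X.inv (X.div δ γ h) = X.div γ δ h.symm := by
  refine X.comp_right_cancel (γ := X.div δ γ h) (h := X.src_inv _)
    (h' := by simp) ?_
  rw [X.inv_comp, div_comp_div, div_same, src_div]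

theorem div_one_right {δ : X.Mor} {x : X.Obj} (h : X.src δ = X.src (X.one x)) :
    X.div δ (X.one x) h = δ := by
  rw [div, X.comp_congr _ rfl (X.inv_one x), X.comp_one']

theorem div_comp_comp {δ δ' γ : X.Mor} (h : X.src δ = X.tgt γ) (h' : X.src δ' = X.tgt γ)
    (H : X.src (X.comp δ γ h) = X.src (X.comp δ' γ h')) :
    X.div (X.comp δ γ h) (X.comp δ' γ h') H = X.div δ δ' (h.trans h'.symm) := by
  refine (eq_div_of_comp_eq (h := by simp [X.tgt_comp]) ?_).symm
  rw [← X.assoc _ _ _ (src_div (h.trans h'.symm)) h', X.comp_congr _ (div_comp _) rfl]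

theorem div_div_div {δ γ ε : X.Mor} (h : X.src δ = X.src ε) (h' : X.src γ = X.src ε)
    (H : X.src (X.div δ ε h) = X.src (X.div γ ε h')) :
    X.div (X.div δ ε h) (X.div γ ε h') H = X.div δ γ (h.trans h'.symm) :=
  div_comp_comp (h.trans (X.tgt_inv ε).symm) (h'.trans (X.tgt_inv ε).symm) H

theorem _root_.Continuous.groupoid_comp {Z : Type*} [TopologicalSpace Z] {a b : Z → X.Mor}
    (ha : Continuous a) (hb : Continuous b) (h : ∀ z, X.src (a z) = X.tgt (b z)) :
    Continuous fun z => X.comp (a z) (b z) (h z) :=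
  X.continuous_comp.comp ((ha.prodMk hb).subtype_mk h)

theorem _root_.Continuous.groupoid_div {Z : Type*} [TopologicalSpace Z] {a b : Z → X.Mor}
    (ha : Continuous a) (hb : Continuous b) (h : ∀ z, X.src (a z) = X.src (b z)) :
    Continuous fun z => X.div (a z) (b z) (h z) :=
  ha.groupoid_comp (X.continuous_inv.comp hb) _

/-- Composition is continuous only on the subspace of composable pairs. Quantifying over the
composability proof turns this into an eventual statement on the full product. -/
theorem eventually_comp_mem {δ γ : X.Mor} (h : X.src δ = X.tgt γ) {T : Set X.Mor}
    (hT : T ∈ 𝓝 (X.comp δ γ h)) :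
    ∀ᶠ p : X.Mor × X.Mor in 𝓝 (δ, γ), ∀ h', X.comp p.1 p.2 h' ∈ T := by
  have h1 := X.continuous_comp.continuousAt (x := ⟨(δ, γ), h⟩) hT
  rw [mem_map, mem_nhds_induced] at h1
  obtain ⟨S, hS, hST⟩ := h1
  filter_upwards [hS] with p hp h'
  exact hST (a := ⟨p, h'⟩) hp

/-! ### Orbit spaces of étale groupoids -/

theorem proj_eq_iff {x y : X.Obj} : X.proj x = X.proj y ↔ ∃ γ, X.src γ = x ∧ X.tgt γ = y :=
  Quotient.eq (r := X.orbitSetoid)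

theorem proj_src_eq_proj_tgt (γ : X.Mor) : X.proj (X.src γ) = X.proj (X.tgt γ) :=
  proj_eq_iff.2 ⟨γ, rfl, rfl⟩

theorem proj_surjective : Function.Surjective X.proj := Quotient.mk_surjective

theorem continuous_proj : Continuous X.proj := continuous_quotient_mk'

theorem isQuotientMap_projH : IsQuotientMap X.projH :=
  (isQuotientMap_quotient_mk' (s := t2Setoid X.OrbitSpace)).comp
    (isQuotientMap_quotient_mk' (s := X.orbitSetoid))

theorem isLocalHomeomorph_src (d : ℕ) (X : TopGroupoid.{u}) [SSEStructure d X] : IsLocalHomeomorph X.src :=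
  (SSEStructure.src_etale (d := d) (X := X)).isLocalHomeomorph

theorem isLocalHomeomorph_tgt (d : ℕ) (X : TopGroupoid.{u}) [SSEStructure d X] : IsLocalHomeomorph X.tgt :=
  (SSEStructure.tgt_etale (d := d) (X := X)).isLocalHomeomorph

/-- The saturation of O is t(s⁻¹(O)), and t is open. -/
theorem isOpenMap_proj (d : ℕ) (X : TopGroupoid.{u}) [SSEStructure d X] : IsOpenMap X.proj := by
  intro O hO
  have h : X.proj ⁻¹' (X.proj '' O) = X.tgt '' (X.src ⁻¹' O) := by
    ext y
    constructor
    · rintro ⟨x, hx, hxy⟩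
      obtain ⟨γ, rfl, rfl⟩ := proj_eq_iff.1 hxy
      exact ⟨γ, hx, rfl⟩
    · rintro ⟨γ, hγ, rfl⟩
      exact ⟨_, hγ, proj_src_eq_proj_tgt γ⟩
  rw [← isQuotientMap_quotient_mk'.isOpen_preimage]
  exact h ▸ (isLocalHomeomorph_tgt d X).isOpenMap _ (hO.preimage X.continuous_src)

/-- The orbit relation is the range of the proper map (s, t), hence closed, and the quotient map is
open. -/
theorem t2Space_orbitSpace (d : ℕ) [SSEStructure d X] (hX : X.IsProper) : T2Space X.OrbitSpace := by
  rw [t2Space_iff_of_isOpenQuotientMap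
    (⟨proj_surjective, continuous_proj, isOpenMap_proj d X⟩ : IsOpenQuotientMap X.proj)]
  convert hX.isClosed_range using 1
  ext ⟨x, y⟩
  simp [proj_eq_iff, Prod.ext_iff]

end TopGroupoid

open TopGroupoid

/-! ### Charts of a good atlas -/

namespace GoodAtlas

variable {d : ℕ} {X : TopGroupoid.{u}} [SSEStructure d X] {ι : Type u} (A : GoodAtlas d X ι)

theorem isOpen_dom (i : ι) : IsOpen (A.dom i) := (A.chart i).open_source

theorem isOpen_cell (i : ι) : IsOpen (A.cell i) := isOpenMap_proj d X _ (A.isOpen_dom i)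

theorem dom_nonempty (i : ι) : (A.dom i).Nonempty := by
  obtain ⟨x, hx⟩ := (A.connected i).nonempty
  exact ⟨_, (A.chart i).map_target hx⟩

include A in
theorem countable_index : Countable ι :=
  Pairwise.countable_of_isOpen_disjoint (s := A.dom) A.disjoint A.isOpen_dom A.dom_nonempty

/-- The morphisms from `x` to the chart domain `Uᵢ`. -/
abbrev HomTo (x : X.Obj) (i : ι) : Type u := {γ : X.Mor // X.src γ = x ∧ X.tgt γ ∈ A.dom i}

theorem nonempty_homTo {x : X.Obj} {i : ι} (hx : X.proj x ∈ A.cell i) : Nonempty (A.HomTo x i) := by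
  obtain ⟨y, hy, hyx⟩ := hx
  obtain ⟨γ, h1, rfl⟩ := proj_eq_iff.1 hyx.symm
  exact ⟨⟨γ, h1, hy⟩⟩

theorem emb_injective_left {i : ι} {g h : A.G i} {x : (A.chart i).source}
    (H : A.emb i g x = A.emb i h x) : g = h := by
  obtain ⟨p, -, hp⟩ := A.emb_bijective i (A.emb i h x) (by rw [A.src_emb]; exact x.2)
    (by rw [A.tgt_emb]; exact (h • x).2)
  exact congrArg Prod.fst ((hp (g, x) H).trans (hp (h, x) rfl).symm)

theorem exists_emb_eq {i : ι} {γ : X.Mor} (x : (A.chart i).source) (h : X.src γ = x)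
    (h' : X.tgt γ ∈ A.dom i) : ∃ g, A.emb i g x = γ := by
  obtain ⟨⟨g, y⟩, hp, -⟩ := A.emb_bijective i γ (by rw [h]; exact x.2) h'
  obtain rfl : y = x := Subtype.ext (by rw [← h, ← hp, A.src_emb])
  exact ⟨g, hp⟩

/-- After one morphism from x into Uᵢ is fixed, composing it with elements of Gᵢ gives every other
one exactly once. -/
theorem card_homTo {x : X.Obj} {i : ι} (hx : X.proj x ∈ A.cell i) :
    Nat.card (A.HomTo x i) = Nat.card (A.G i) := by
  obtain ⟨γ, h1, h2⟩ := A.nonempty_homTo hx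
  let y : (A.chart i).source := ⟨X.tgt γ, h2⟩
  symm
  refine Nat.card_congr (Equiv.ofBijective (fun g => ⟨X.comp (A.emb i g y) γ (A.src_emb i g y),
    (X.src_comp _ _ _).trans h1, ?_⟩) ⟨fun g h H => ?_, fun δ => ?_⟩)
  · rw [X.tgt_comp, A.tgt_emb]
    exact (g • y).2
  · exact A.emb_injective_left (X.comp_right_cancel (congrArg Subtype.val H))
  · obtain ⟨δ, h3, h4⟩ := δ
    obtain ⟨g, hg⟩ := A.exists_emb_eq (γ := X.div δ γ (h3.trans h1.symm)) y (src_div _)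
      (by rw [tgt_div]; exact h4)
    refine ⟨g, Subtype.ext ?_⟩
    dsimp only
    rw [X.comp_congr _ hg rfl, div_comp]

theorem card_homTo_pi {x₀ : X.Obj} {I : IndexSet ι} (hx : ∀ i ∈ I.1, X.proj x₀ ∈ A.cell i) :
    Nat.card (∀ i : I.1, A.HomTo x₀ i) = A.groupCard I := by
  rw [GoodAtlas.groupCard, Nat.card_pi, Nat.card_pi]
  exact Finset.prod_congr rfl fun i _ => A.card_homTo (hx i i.2)

theorem groupCard_pos (I : IndexSet ι) : 0 < A.groupCard I := Nat.card_pos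

theorem continuous_smul (i : ι) (g : A.G i) :
    Continuous fun x : (A.chart i).source => (g • x : (A.chart i).source) := by
  rw [continuous_induced_rng]
  have := X.continuous_tgt.comp (A.continuous_emb i g)
  convert this using 1
  ext x
  exact (A.tgt_emb i g x).symm

/-- The projection from a chart domain `Uᵢ` to `|Uᵢ|` is proper. -/
theorem exists_ultrafilter_le_nhds {i : ι} {w : X.OrbitSpace} (hw : w ∈ A.cell i)
    {𝒲 : Ultrafilter X.Obj} (h𝒲 : A.dom i ∈ 𝒲) (h : Tendsto X.proj 𝒲 (𝓝 w)) :
    ∃ x ∈ A.dom i, X.proj x = w ∧ ↑𝒲 ≤ 𝓝 x := by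
  obtain ⟨x₀, hx₀, rfl⟩ := hw
  let y₀ : (A.chart i).source := ⟨x₀, hx₀⟩
  -- If no translate of x₀ is a limit, each has a neighbourhood outside the ultrafilter. Points of
  -- Uᵢ with image near w are translates of points near x₀, so the finite union of these
  -- neighbourhoods does belong to the ultrafilter, which is impossible.
  by_contra! hcon
  have h1 : ∀ g : A.G i, ∃ O, O ∈ 𝓝 ((g • y₀ : (A.chart i).source) : X.Obj) ∧ O ∉ 𝒲 := by
    intro g
    have h2 := hcon _ (g • y₀).2 (by
      rw [← A.tgt_emb, ← proj_src_eq_proj_tgt, A.src_emb])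
    obtain ⟨O, hO, hO'⟩ := Filter.not_le.1 h2
    exact ⟨O, hO, hO'⟩
  choose O hO hO' using h1
  have h3 : ∀ᶠ y : (A.chart i).source in 𝓝 y₀, ∀ g : A.G i,
      ((g • y : (A.chart i).source) : X.Obj) ∈ O g := by
    rw [eventually_all]
    exact fun g => (continuous_subtype_val.comp (A.continuous_smul i g)).continuousAt (hO g)
  rw [nhds_subtype, eventually_comap] at h3
  have h3' := (isOpenMap_proj d X).image_mem_nhds (inter_mem h3 ((A.isOpen_dom i).mem_nhds hx₀))
  have h5 : (⋃ g, O g) ∈ 𝒲 := by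
    filter_upwards [h h3', h𝒲] with x hx hxi
    obtain ⟨y, ⟨hy, hyi⟩, hyx⟩ := hx
    obtain ⟨γ, rfl, rfl⟩ := proj_eq_iff.1 hyx
    obtain ⟨g, hg⟩ := A.exists_emb_eq ⟨X.src γ, hyi⟩ rfl hxi
    rw [← hg, A.tgt_emb]
    exact mem_iUnion.2 ⟨g, hy _ rfl g⟩
  rw [← biUnion_univ, Ultrafilter.finite_biUnion_mem_iff finite_univ] at h5
  obtain ⟨g, -, hg⟩ := h5
  exact hO' g hg

end GoodAtlas

end Orbi

noncomputable section
namespace Orbi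

open TopGroupoid

theorem isLocalHomeomorph_of_isOpenMap {Y Z : Type*} [TopologicalSpace Y] [TopologicalSpace Z]
    {f : Y → Z} (hf : Continuous f) (hf' : IsOpenMap f) (h : ∀ y, ∃ U ∈ 𝓝 y, InjOn f U) :
    IsLocalHomeomorph f := by
  refine isLocalHomeomorph_iff_isOpenEmbedding_restrict.2 fun y => ?_
  obtain ⟨U, hU, hfU⟩ := h y
  refine ⟨interior U, interior_mem_nhds.2 hU, .of_continuous_injective_isOpenMap
    (hf.comp continuous_subtype_val) ?_ (hf'.comp isOpen_interior.isOpenMap_subtype_val)⟩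
  exact (injOn_iff_injective).1 (hfU.mono interior_subset)

/-! ### Spaces of tuples -/

namespace Tuple

variable {d : ℕ} {X : TopGroupoid.{u}} [SSEStructure d X] {ι : Type u} [LinearOrder ι]
  {A : GoodAtlas d X ι} {I J : IndexSet ι}

theorem ext {z z' : Tuple A I} (h : z.obj = z'.obj) (h' : z.hom = z'.hom) : z = z' := by
  cases z; cases z'; cases h; cases h'; rfl

theorem isEmbedding_obj_hom : IsEmbedding fun z : Tuple A I => (z.obj, z.hom) :=
  ⟨⟨rfl⟩, fun _ _ h => ext (congrArg Prod.fst h) (congrArg Prod.snd h)⟩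

instance : T2Space (Tuple A I) := isEmbedding_obj_hom.t2Space

instance : SecondCountableTopology (Tuple A I) := isEmbedding_obj_hom.secondCountableTopology

theorem continuous_obj (i : I.1) : Continuous fun z : Tuple A I => z.obj i :=
  (continuous_apply i).comp (continuous_fst.comp isEmbedding_obj_hom.continuous)

theorem continuous_hom (p : {p : I.1 × I.1 // p.1 ≤ p.2}) :
    Continuous fun z : Tuple A I => z.hom p :=
  (continuous_apply p).comp (continuous_snd.comp isEmbedding_obj_hom.continuous)

theorem continuous_of {Z : Type*} [TopologicalSpace Z] {f : Z → Tuple A I}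
    (h : ∀ i, Continuous fun x => (f x).obj i) (h' : ∀ p, Continuous fun x => (f x).hom p) :
    Continuous f :=
  isEmbedding_obj_hom.continuous_iff.2 ((continuous_pi h).prodMk (continuous_pi h'))

/-- The composite morphism in a tuple from the object with index `i` to the one with index `j`,
for arbitrary indices. -/
def mor (z : Tuple A I) (i j : I.1) : X.Mor :=
  X.div (z.hom ⟨(I.first, j), I.first_le j⟩) (z.hom ⟨(I.first, i), I.first_le i⟩)
    ((z.src_hom ⟨(I.first, j), _⟩).trans (z.src_hom ⟨(I.first, i), _⟩).symm)

@[simp] theorem src_mor (z : Tuple A I) (i j : I.1) : X.src (z.mor i j) = z.obj i := by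
  rw [mor, src_div, z.tgt_hom]

@[simp] theorem tgt_mor (z : Tuple A I) (i j : I.1) : X.tgt (z.mor i j) = z.obj j := by
  rw [mor, tgt_div, z.tgt_hom]

theorem mor_of_le (z : Tuple A I) {i j : I.1} (h : i ≤ j) : z.mor i j = z.hom ⟨(i, j), h⟩ := by
  rw [mor, div_congr _ (z.hom_trans I.first i j (I.first_le i) h) rfl, comp_div]

theorem mor_self (z : Tuple A I) (i : I.1) : z.mor i i = X.one (z.obj i) := by
  rw [mor_of_le z le_rfl, z.hom_refl]

theorem mor_comp (z : Tuple A I) (i j k : I.1) (h : X.src (z.mor j k) = X.tgt (z.mor i j)) :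
    X.comp (z.mor j k) (z.mor i j) h = z.mor i k := div_comp_div _ _ _

theorem inv_mor (z : Tuple A I) (i j : I.1) : X.inv (z.mor i j) = z.mor j i := inv_div _

theorem continuous_mor (i j : I.1) : Continuous fun z : Tuple A I => z.mor i j :=
  (continuous_hom _).groupoid_div (continuous_hom _) _

@[simp] theorem mor_restrict (h : J.1 ⊆ I.1) (z : Tuple A I) (i j : J.1) :
    (z.restrict h).mor i j = z.mor ⟨i.1, h i.2⟩ ⟨j.1, h j.2⟩ := by
  rcases le_total i j with hij | hij
  · rw [mor_of_le _ hij, mor_of_le z (i := ⟨i.1, h i.2⟩) (j := ⟨j.1, h j.2⟩) hij]; rfl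
  · rw [← inv_mor, ← inv_mor z, mor_of_le _ hij,
      mor_of_le z (i := ⟨j.1, h j.2⟩) (j := ⟨i.1, h i.2⟩) hij]; rfl

theorem continuous_restrict (h : J.1 ⊆ I.1) :
    Continuous fun z : Tuple A I => z.restrict h :=
  continuous_of (fun _ => continuous_obj _) (fun _ => continuous_hom _)

theorem proj_obj (z : Tuple A I) (i : I.1) : X.proj (z.obj i) = z.proj :=
  proj_eq_iff.2 ⟨z.mor i I.first, src_mor .., tgt_mor ..⟩

@[simp] theorem proj_restrict (h : J.1 ⊆ I.1) (z : Tuple A I) : (z.restrict h).proj = z.proj :=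
  proj_obj z _

theorem continuous_proj : Continuous (Tuple.proj : Tuple A I → X.OrbitSpace) :=
  TopGroupoid.continuous_proj.comp (continuous_obj _)

/-! ### Tuples as families of morphisms with a common source -/

variable (A I) in
/-- Families of morphisms with a common source and with targets in the charts `Uᵢ`, `i ∈ I`. -/
abbrev Frame : Type u :=
  {p : X.Obj × (I.1 → X.Mor) // ∀ j, X.src (p.2 j) = p.1 ∧ X.tgt (p.2 j) ∈ A.dom j}

/-- The tuple of the targets of a family of morphisms with common source. -/
def ofFrame (p : Frame A I) : Tuple A I where
  obj j := X.tgt (p.1.2 j)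
  hom q := X.div (p.1.2 q.1.2) (p.1.2 q.1.1) ((p.2 _).1.trans (p.2 _).1.symm)
  obj_mem j := (p.2 j).2
  src_hom _ := src_div _
  tgt_hom _ := tgt_div _
  hom_refl _ := div_same _
  hom_trans _ _ _ _ _ := (div_comp_div _ _ _).symm

/-- The family of the morphisms in a tuple that start at the object with index `k`. -/
def frame (k : I.1) (z : Tuple A I) : Frame A I :=
  ⟨(z.obj k, fun j => z.mor k j), fun j => ⟨src_mor .., by rw [tgt_mor]; exact z.obj_mem j⟩⟩

theorem ofFrame_frame (k : I.1) (z : Tuple A I) : ofFrame (frame k z) = z := by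
  refine ext (funext fun j => tgt_mor ..) (funext fun q => ?_)
  have h1 : X.src (z.hom q) = X.tgt (z.mor k q.1.1) := by rw [z.src_hom, tgt_mor]
  refine (eq_div_of_comp_eq (h := h1) ?_).symm
  rw [X.comp_congr _ (mor_of_le z q.2).symm rfl, mor_comp]
  rfl

theorem mor_ofFrame (p : Frame A I) (i j : I.1) :
    (ofFrame p).mor i j = X.div (p.1.2 j) (p.1.2 i) ((p.2 _).1.trans (p.2 _).1.symm) :=
  div_div_div ((p.2 _).1.trans (p.2 _).1.symm) ((p.2 _).1.trans (p.2 _).1.symm) _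

theorem restrict_ofFrame (h : J.1 ⊆ I.1) (p : Frame A I) (q : Frame A J)
    (hpq : ∀ j : J.1, p.1.2 ⟨j.1, h j.2⟩ = q.1.2 j) :
    (ofFrame p).restrict h = ofFrame q :=
  ext (funext fun j => congrArg X.tgt (hpq j)) (funext fun q =>
    div_congr ((p.2 _).1.trans (p.2 _).1.symm) (hpq q.1.2) (hpq q.1.1))

theorem ofFrame_congr {p q : Frame A I} (h : ∀ j, p.1.2 j = q.1.2 j) : ofFrame p = ofFrame q :=
  restrict_ofFrame (Finset.Subset.refl _) p q h

/-- The morphism from index i to index j is recovered as the quotient of those from k to j and from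
k to i. -/
theorem eq_of_frame {z z' : Tuple A I} (k : I.1) (h : ∀ j, z.mor k j = z'.mor k j) : z = z' := by
  rw [← ofFrame_frame k z, ← ofFrame_frame k z']
  exact ofFrame_congr h

theorem continuous_ofFrame : Continuous (ofFrame : Frame A I → Tuple A I) := by
  have h (j : I.1) : Continuous fun p : Frame A I => p.1.2 j := by fun_prop
  exact continuous_of (fun j => X.continuous_tgt.comp (h j))
    (fun q => (h q.1.2).groupoid_div (h q.1.1) fun p => (p.2 _).1.trans (p.2 _).1.symm)

/-! ### The objects of a tuple as local coordinates -/

/-- The source map is locally injective, so near z the object with index k determines all morphisms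
that leave it, hence the tuple. One neighbourhood serves all k. -/
theorem exists_injOn_obj (z : Tuple A I) : ∃ T ∈ 𝓝 z, ∀ k : I.1,
    InjOn (fun z' : Tuple A I => z'.obj k) T := by
  have h (γ : X.Mor) : ∃ S ∈ 𝓝 γ, InjOn X.src S := by
    obtain ⟨S, h1, h2, h3⟩ := (isLocalHomeomorph_src d X).isLocallyInjective γ
    exact ⟨S, h1.mem_nhds h2, h3⟩
  choose S hS hS' using h
  refine ⟨{z' | ∀ k j : I.1, z'.mor k j ∈ S (z.mor k j)}, ?_, fun k z₁ h₁ z₂ h₂ H => ?_⟩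
  · have : ∀ᶠ z' in 𝓝 z, ∀ k j : I.1, z'.mor k j ∈ S (z.mor k j) :=
      eventually_all.2 fun k => eventually_all.2 fun j =>
        (continuous_mor k j).continuousAt (hS _)
    exact this
  · exact eq_of_frame k fun j => hS' _ (h₁ k j) (h₂ k j) (by simpa using H)

/-- When the object with index k moves slightly, the morphisms leaving it move along, since the
source map is open. -/
theorem isOpenMap_obj (k : I.1) : IsOpenMap fun z : Tuple A I => z.obj k := by
  refine IsOpenMap.of_nhds_le fun z T hT => ?_
  rw [mem_map] at hT
  have h1 : ofFrame ⁻¹' ((fun z : Tuple A I => z.obj k) ⁻¹' T) ∈ 𝓝 (frame k z) :=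
    continuous_ofFrame.continuousAt (by rwa [ofFrame_frame])
  rw [mem_nhds_induced] at h1
  obtain ⟨S, hS, hST⟩ := h1
  obtain ⟨O, hO, Q, hQ, hOQ⟩ := mem_nhds_prod_iff.1 hS
  change O ∈ 𝓝 (z.obj k) at hO
  change Q ∈ 𝓝 fun j => z.mor k j at hQ
  rw [nhds_pi, mem_pi'] at hQ
  obtain ⟨F, B, hB, hBQ⟩ := hQ
  have h2 : ∀ᶠ x in 𝓝 (z.obj k), ∀ j : I.1, ∃ γ ∈ B j, X.src γ = x ∧ X.tgt γ ∈ A.dom j ∧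
      (j = k → γ = X.one x) := by
    refine eventually_all.2 fun j => ?_
    -- The morphism with index k has to be the identity: the object with index k in the new tuple is
    -- its target, and this must be x.
    by_cases hj : j = k
    · subst hj
      have h3 : Tendsto X.one (𝓝 (z.obj j)) (𝓝 (z.mor j j)) := by
        rw [mor_self]; exact X.continuous_one.continuousAt
      filter_upwards [h3 (hB j), (A.isOpen_dom j).mem_nhds (z.obj_mem j)] with x hx hx'
      exact ⟨_, hx, X.src_one x, by rwa [X.tgt_one], fun _ => rfl⟩
    · have h3 : B j ∩ X.tgt ⁻¹' A.dom j ∈ 𝓝 (z.mor k j) :=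
        inter_mem (hB j) (X.continuous_tgt.continuousAt ((A.isOpen_dom j).mem_nhds (by
          rw [tgt_mor]; exact z.obj_mem j)))
      have h4 := (isLocalHomeomorph_src d X).isOpenMap.image_mem_nhds h3
      rw [src_mor] at h4
      filter_upwards [h4] with x hx
      obtain ⟨γ, h5, rfl⟩ := hx
      exact ⟨γ, h5.1, rfl, h5.2, fun h => absurd h hj⟩
  filter_upwards [h2, hO] with x hx hxO
  choose γ h3 h4 h5 h6 using hx
  have h7 := @hST ⟨(x, γ), fun j => ⟨h4 j, h5 j⟩⟩ (hOQ ⟨hxO, hBQ fun j _ => h3 j⟩)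
  change X.tgt (γ k) ∈ T at h7
  rwa [h6 k rfl, X.tgt_one] at h7

theorem isLocalHomeomorph_obj (k : I.1) : IsLocalHomeomorph fun z : Tuple A I => z.obj k :=
  isLocalHomeomorph_of_isOpenMap (continuous_obj k) (isOpenMap_obj k) fun z =>
    let ⟨T, hT, h⟩ := exists_injOn_obj z
    ⟨T, hT, h k⟩

/-- In the coordinates given by an object whose index lies in J, restriction is the identity. -/
theorem isLocalHomeomorph_restrict (h : J.1 ⊆ I.1) :
    IsLocalHomeomorph fun z : Tuple A I => z.restrict h :=
  IsLocalHomeomorph.of_comp (g := fun z : Tuple A J => z.obj J.first)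
    (isLocalHomeomorph_obj (⟨J.first.1, h J.first.2⟩ : I.1)) (isLocalHomeomorph_obj _)
    (continuous_restrict h)

theorem isOpenMap_proj : IsOpenMap (Tuple.proj : Tuple A I → X.OrbitSpace) :=
  (TopGroupoid.isOpenMap_proj d X).comp (isOpenMap_obj _)

/-! ### The fibres of the projections between spaces of tuples -/

/-- Keep the morphisms of x that leave its first object and choose arbitrary ones into Uᵢ for the
new indices. -/
theorem exists_restrict_eq (h : J.1 ⊆ I.1) (x : Tuple A J) (hx : ∀ i ∈ I.1, x.proj ∈ A.cell i) :
    ∃ z : Tuple A I, z.restrict h = x := by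
  classical
  have h1 (j : I.1) : ∃ γ : X.Mor, X.src γ = x.obj J.first ∧ X.tgt γ ∈ A.dom j ∧
      ∀ hj : j.1 ∈ J.1, γ = x.mor J.first ⟨j.1, hj⟩ := by
    by_cases hj : j.1 ∈ J.1
    · exact ⟨x.mor J.first ⟨j.1, hj⟩, src_mor .., by rw [tgt_mor]; exact x.obj_mem ⟨j.1, hj⟩,
        fun _ => rfl⟩
    · obtain ⟨γ, h1, h2⟩ := A.nonempty_homTo (hx j j.2)
      exact ⟨γ, h1, h2, fun h => absurd h hj⟩
  choose γ h2 h3 h4 using h1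
  refine ⟨ofFrame ⟨(x.obj J.first, γ), fun j => ⟨h2 j, h3 j⟩⟩, ?_⟩
  exact (restrict_ofFrame _ _ (frame J.first x) fun j => h4 ⟨j.1, h j.2⟩ j.2).trans
    (ofFrame_frame _ _)

/-- The left side counts families of morphisms from the first object of x into the charts Uᵢ, i ∈ I.
The entries outside J, completed by those of x, form a tuple in the fibre; the entries in J form an
independent family, counted by |G_J|. -/
theorem card_restrict_fibre (h : J.1 ⊆ I.1) (x : Tuple A J)
    (hx : ∀ i ∈ I.1, x.proj ∈ A.cell i) :
    A.groupCard I = Nat.card {z : Tuple A I // z.restrict h = x} * A.groupCard J := by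
  classical
  have hx' : ∀ i ∈ I.1, X.proj (x.obj J.first) ∈ A.cell i := hx
  rw [← A.card_homTo_pi hx', ← A.card_homTo_pi fun i hi => hx' i (h hi), ← Nat.card_prod]
  let k : I.1 := ⟨J.first.1, h J.first.2⟩
  let glue (p : ∀ i : I.1, A.HomTo (x.obj J.first) i) : Frame A I :=
    ⟨(x.obj J.first, fun j => if hj : j.1 ∈ J.1 then x.mor J.first ⟨j.1, hj⟩ else p j), fun j => by
      dsimp only
      split_ifs with hj
      · exact ⟨src_mor .., by rw [tgt_mor]; exact x.obj_mem ⟨j.1, hj⟩⟩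
      · exact (p j).2⟩
  refine Nat.card_congr
    { toFun := fun p => (⟨ofFrame (glue p), ?_⟩, fun j => p ⟨j.1, h j.2⟩)
      invFun := fun q j => if hj : j.1 ∈ J.1 then q.2 ⟨j.1, hj⟩ else
        ⟨q.1.1.mor k j, ?_, by rw [tgt_mor]; exact q.1.1.obj_mem j⟩
      left_inv := fun p => funext fun j => ?_
      right_inv := ?_ }
  · refine (restrict_ofFrame _ _ (frame J.first x) fun j => ?_).trans (ofFrame_frame _ _)
    simp [glue, frame]
  · rw [src_mor]; exact congrArg (fun z => z.obj J.first) q.1.2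
  · dsimp only
    split_ifs with hj
    · rfl
    · refine Subtype.ext ?_
      have h1 : (glue p).1.2 k = X.one (x.obj J.first) := by
        simp only [glue, k]
        rw [dif_pos J.first.2]
        exact mor_self x J.first
      have h2 : (glue p).1.2 j = p j := dif_neg hj
      change (ofFrame (glue p)).mor k j = p j
      rw [mor_ofFrame, div_congr _ h2 h1, div_one_right]
  · rintro ⟨⟨z, rfl⟩, q⟩
    refine Prod.ext (Subtype.ext ?_) (funext fun j => ?_)
    · refine (ofFrame_congr (q := frame k z) fun j => ?_).trans (ofFrame_frame k z)
      by_cases hj : j.1 ∈ J.1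
      · simp [glue, hj, frame, k]
      · simp [glue, hj, frame, k]
    · exact dif_pos j.2

/-- Choose for every tuple z over the orbit a morphism τ from x₀ to its first object. Sending (z, σ)
to the composites of σ, τ and the morphisms of z matches pairs with families of morphisms from x₀
into the charts. -/
theorem card_proj_fibre (x₀ : X.Obj) (hx : ∀ i ∈ I.1, X.proj x₀ ∈ A.cell i) :
    A.groupCard I = Nat.card {z : Tuple A I // z.proj = X.proj x₀} * Nat.card (X.Stab x₀) := by
  rw [← A.card_homTo_pi hx, ← Nat.card_prod]
  have h1 (z : {z : Tuple A I // z.proj = X.proj x₀}) :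
      ∃ γ, X.src γ = x₀ ∧ X.tgt γ = z.1.obj I.first := proj_eq_iff.1 z.2.symm
  choose τ hτ hτ' using h1
  symm
  have hσ (q : {z : Tuple A I // z.proj = X.proj x₀} × X.Stab x₀) :
      X.src (τ q.1) = X.tgt q.2.1 := (hτ _).trans q.2.2.2.symm
  have hm (q : {z : Tuple A I // z.proj = X.proj x₀} × X.Stab x₀) (j : I.1) :
      X.src (q.1.1.mor I.first j) = X.tgt (X.comp (τ q.1) q.2.1 (hσ q)) := by
    rw [X.tgt_comp, src_mor, hτ']
  let Φ (q : {z : Tuple A I // z.proj = X.proj x₀} × X.Stab x₀) (j : I.1) : A.HomTo x₀ j :=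
    ⟨X.comp (q.1.1.mor I.first j) (X.comp (τ q.1) q.2.1 (hσ q)) (hm q j),
      by rw [X.src_comp, X.src_comp, q.2.2.1],
      by rw [X.tgt_comp, tgt_mor]; exact q.1.1.obj_mem j⟩
  let fr (p : ∀ j : I.1, A.HomTo x₀ j) : Frame A I := ⟨(x₀, fun j => (p j).1), fun j => (p j).2⟩
  have hΦ (q) : ofFrame (fr (Φ q)) = q.1.1 := by
    refine eq_of_frame I.first fun j => ?_
    rw [mor_ofFrame]
    refine (div_comp_comp (hm q j) (hm q I.first) _).trans ?_
    rw [div_congr _ rfl (mor_self _ _), div_one_right]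
  refine Nat.card_congr (Equiv.ofBijective Φ ⟨fun q q' H => ?_, fun p => ?_⟩)
  · have h1 : q.1 = q'.1 := Subtype.ext (by rw [← hΦ q, ← hΦ q', H])
    obtain ⟨z, σ⟩ := q
    obtain ⟨z', σ'⟩ := q'
    obtain rfl : z = z' := h1
    have h2 := congrArg Subtype.val (congrFun H I.first)
    exact Prod.ext rfl (Subtype.ext (X.comp_left_cancel (X.comp_left_cancel h2)))
  · have hz : (ofFrame (fr p)).proj = X.proj x₀ :=
      proj_eq_iff.2 ⟨X.inv (p I.first).1, (X.src_inv _).trans rfl,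
        (X.tgt_inv _).trans (p I.first).2.1⟩
    let z : {z : Tuple A I // z.proj = X.proj x₀} := ⟨ofFrame (fr p), hz⟩
    have h2 : X.tgt (τ z) = X.tgt (p I.first).1 := hτ' z
    have h3 : X.src (X.inv (τ z)) = X.tgt (p I.first).1 := by rw [X.src_inv, h2]
    refine ⟨⟨z, ⟨X.comp (X.inv (τ z)) (p I.first).1 h3, by rw [X.src_comp]; exact (p I.first).2.1,
      by rw [X.tgt_comp, X.tgt_inv, hτ]⟩⟩, funext fun j => Subtype.ext ?_⟩
    have h4 : X.comp (τ z) (X.comp (X.inv (τ z)) (p I.first).1 h3)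
        (by rw [X.tgt_comp, X.tgt_inv]) = (p I.first).1 := by
      rw [← X.assoc _ _ _ (X.tgt_inv _).symm h3, X.comp_congr _ (X.comp_inv _) rfl, X.one_comp']
    have h5 : (ofFrame (fr p)).mor I.first j = X.div (p j).1 (p I.first).1 _ := mor_ofFrame ..
    change X.comp ((ofFrame (fr p)).mor I.first j) _ _ = (p j).1
    rw [X.comp_congr _ h5 h4, div_comp]

theorem finite_proj_fibre {w : X.OrbitSpace} (hw : ∀ i ∈ I.1, w ∈ A.cell i) :
    Finite {z : Tuple A I // z.proj = w} := by
  obtain ⟨x₀, rfl⟩ := proj_surjective w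
  have h := card_proj_fibre x₀ hw
  -- An infinite fibre would have `Nat.card` equal to 0, contradicting |G_I| > 0 in the counting
  -- formula.
  refine Nat.finite_of_card_ne_zero fun h0 => ?_
  rw [h0, zero_mul] at h
  exact (A.groupCard_pos I).ne' h

/-- The projection from the space of tuples to `|U_I|` is proper. -/
theorem exists_ultrafilter_le_nhds (hX : X.IsProper) {w : X.OrbitSpace}
    (hw : ∀ i ∈ I.1, w ∈ A.cell i) {𝒲 : Ultrafilter (Tuple A I)} (h : Tendsto Tuple.proj (𝒲 : Filter (Tuple A I)) (𝓝 w)) :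
    ∃ z : Tuple A I, z.proj = w ∧ ↑𝒲 ≤ 𝓝 z := by
  have h1 (i : I.1) : ∃ x ∈ A.dom i, X.proj x = w ∧
      Tendsto (fun z : Tuple A I => z.obj i) 𝒲 (𝓝 x) :=
    A.exists_ultrafilter_le_nhds (𝒲 := 𝒲.map fun z : Tuple A I => z.obj i) (hw i i.2)
      (Filter.Eventually.of_forall (f := (𝒲 : Filter (Tuple A I))) fun z => z.obj_mem i) (by
        rw [Ultrafilter.coe_map, tendsto_map'_iff]
        exact h.congr fun z => (proj_obj z i).symm)
  choose y hy hyw hlim using h1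
  -- The objects converge by properness of the charts over |X|; properness of (s, t) then gives
  -- limits of the morphisms between them.
  have h2 (j : I.1) : ∃ γ, (X.src γ, X.tgt γ) = (y I.first, y j) ∧
      Tendsto (fun z : Tuple A I => z.mor I.first j) 𝒲 (𝓝 γ) :=
    hX.ultrafilter_le_nhds_of_tendsto (𝒰 := 𝒲.map fun z : Tuple A I => z.mor I.first j) (by
      rw [Ultrafilter.coe_map, tendsto_map'_iff]
      refine ((hlim I.first).prodMk_nhds (hlim j)).congr fun z => ?_
      simp)
  choose γ hγ hγlim using h2
  simp only [Prod.mk.injEq] at hγ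
  let p : Frame A I := ⟨(y I.first, γ), fun j => ⟨(hγ j).1, by rw [(hγ j).2]; exact hy j⟩⟩
  have h3 : Tendsto (frame I.first) 𝒲 (𝓝 p) := by
    rw [tendsto_subtype_rng]
    exact (hlim I.first).prodMk_nhds (tendsto_pi_nhds.2 hγlim)
  refine ⟨ofFrame p, ?_, ?_⟩
  · change X.proj (X.tgt (γ I.first)) = w
    rw [(hγ _).2, hyw]
  · have := (continuous_ofFrame.tendsto p).comp h3
    exact tendsto_id'.1 (this.congr fun z => ofFrame_frame _ _)

end Tuple
end Orbi
end

noncomputable section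
namespace Orbi

open TopGroupoid

/-! ### Combinatorics of a compatible cover -/

namespace CompatibleCover

variable {d : ℕ} {X : TopGroupoid.{u}} [SSEStructure d X] {ι : Type u} {A : GoodAtlas d X ι}
  (𝒱 : CompatibleCover A)

theorem mem_cell_of_mem_closure {w : X.OrbitSpace} {I : IndexSet ι} (h : w ∈ closure (𝒱.V I)) :
    ∀ i ∈ I.1, w ∈ A.cell i := by
  simpa using 𝒱.closure_subset I h

theorem mem_cell_of_mem {w : X.OrbitSpace} {I : IndexSet ι} (h : w ∈ 𝒱.V I) :
    ∀ i ∈ I.1, w ∈ A.cell i :=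
  𝒱.mem_cell_of_mem_closure (subset_closure h)

theorem subset_or_subset {w : X.OrbitSpace} {I J : IndexSet ι} (hI : w ∈ closure (𝒱.V I))
    (hJ : w ∈ closure (𝒱.V J)) : I.1 ⊆ J.1 ∨ J.1 ⊆ I.1 := by
  have h1 : (𝒱.V I).Nonempty := closure_nonempty_iff.1 ⟨w, hI⟩
  have h2 : (𝒱.V J).Nonempty := closure_nonempty_iff.1 ⟨w, hJ⟩
  exact (𝒱.inter_iff I J h1 h2).1 ((𝒱.closure_inter_iff I J h1 h2).1 ⟨w, hI, hJ⟩)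

/-- Index sets whose closed cells contain w are pairwise comparable, so one of least cardinality
lies in all the others. -/
theorem exists_least {w : X.OrbitSpace} (P : IndexSet ι → Prop) (hP : ∃ I, P I)
    (h : ∀ I, P I → w ∈ closure (𝒱.V I)) : ∃ I, P I ∧ ∀ J, P J → I.1 ⊆ J.1 := by
  obtain ⟨I, hI, hmin⟩ := (measure fun I : IndexSet ι => I.1.card).wf.has_min {I | P I} hP
  refine ⟨I, hI, fun J hJ => ?_⟩
  rcases 𝒱.subset_or_subset (h I hI) (h J hJ) with h1 | h1
  · exact h1
  · exact (Finset.eq_of_subset_of_card_le h1 (not_lt.1 (hmin J hJ))).symm.subset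

theorem exists_mem (w : X.OrbitSpace) : ∃ I, w ∈ 𝒱.V I :=
  mem_iUnion.1 (𝒱.cover.symm ▸ mem_univ w)

/-- The smallest index set `I` with `w ∈ |V_I|`. -/
def low (w : X.OrbitSpace) : IndexSet ι :=
  (𝒱.exists_least (fun I => w ∈ 𝒱.V I) (𝒱.exists_mem w) fun _ h => subset_closure h).choose

theorem mem_low (w : X.OrbitSpace) : w ∈ 𝒱.V (𝒱.low w) :=
  (𝒱.exists_least (fun I => w ∈ 𝒱.V I) (𝒱.exists_mem w)
    fun _ h => subset_closure h).choose_spec.1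

theorem low_subset {w : X.OrbitSpace} {I : IndexSet ι} (h : w ∈ 𝒱.V I) :
    (𝒱.low w).1 ⊆ I.1 :=
  (𝒱.exists_least (fun I => w ∈ 𝒱.V I) (𝒱.exists_mem w)
    fun _ h => subset_closure h).choose_spec.2 I h

/-- The smallest index set `I` with `w` in the closure of `|V_I|`. -/
def clow (w : X.OrbitSpace) : IndexSet ι :=
  (𝒱.exists_least (fun I => w ∈ closure (𝒱.V I)) ((𝒱.exists_mem w).imp fun _ h => subset_closure h)
    fun _ h => h).choose

theorem mem_clow (w : X.OrbitSpace) : w ∈ closure (𝒱.V (𝒱.clow w)) :=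
  (𝒱.exists_least (fun I => w ∈ closure (𝒱.V I)) ((𝒱.exists_mem w).imp fun _ h => subset_closure h)
    fun _ h => h).choose_spec.1

theorem clow_subset {w : X.OrbitSpace} {I : IndexSet ι} (h : w ∈ closure (𝒱.V I)) :
    (𝒱.clow w).1 ⊆ I.1 :=
  (𝒱.exists_least (fun I => w ∈ closure (𝒱.V I)) ((𝒱.exists_mem w).imp fun _ h => subset_closure h)
    fun _ h => h).choose_spec.2 I h

theorem clow_subset_of_mem {w : X.OrbitSpace} {I : IndexSet ι} (h : w ∈ 𝒱.V I) :
    (𝒱.clow w).1 ⊆ I.1 :=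
  𝒱.clow_subset (subset_closure h)

theorem clow_subset_low (w : X.OrbitSpace) : (𝒱.clow w).1 ⊆ (𝒱.low w).1 :=
  𝒱.clow_subset_of_mem (𝒱.mem_low w)

theorem eq_clow_of_isMinIndex {w : X.OrbitSpace} {I : IndexSet ι} : 𝒱.IsMinIndex w I → I = 𝒱.clow w := by
  rintro ⟨h1, h2⟩
  exact Subtype.ext (Finset.eq_of_subset_of_card_le (𝒱.clow_subset h1)
    (h2 _ (𝒱.mem_clow w))).symm

/-- A neighbourhood that meets only finitely many |Uᵢ| can meet |V_I| only if I is made of these i.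
-/
theorem locallyFinite_V : LocallyFinite 𝒱.V := by
  intro w
  obtain ⟨N, hN, hfin⟩ := A.locallyFinite w
  refine ⟨N, hN, ?_⟩
  have h1 : {I : IndexSet ι | I.1 ∈ (hfin.toFinset.powerset : Set (Finset ι))}.Finite :=
    (Finset.finite_toSet _).preimage Subtype.val_injective.injOn
  refine h1.subset ?_
  rintro I ⟨w', hw', hw'N⟩
  simp only [Finset.coe_powerset, mem_preimage, mem_powerset_iff, mem_ofPred_eq]
  intro i hi
  simp only [Finset.mem_coe, Finite.mem_toFinset, mem_ofPred_eq]
  exact ⟨w', 𝒱.mem_cell_of_mem hw' i hi, hw'N⟩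

theorem eventually_mem_closure (w : X.OrbitSpace) :
    ∀ᶠ w' in 𝓝 w, ∀ I, w' ∈ closure (𝒱.V I) → w ∈ closure (𝒱.V I) := by
  filter_upwards [𝒱.locallyFinite_V.closure.eventually_subset (fun _ => isClosed_closure) w]
    with w' h I hI using h hI

/-- By local finiteness no new closure appears near w. This semicontinuity yields both the Hausdorff
property of the quotient and the injectivity of the branches. -/
theorem eventually_clow_subset (w : X.OrbitSpace) :
    ∀ᶠ w' in 𝓝 w, (𝒱.clow w).1 ⊆ (𝒱.clow w').1 := by
  filter_upwards [𝒱.eventually_mem_closure w] with w' h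
  exact 𝒱.clow_subset (h _ (𝒱.mem_clow w'))

/-! ### The equivalence relation generated by the projections -/

variable [LinearOrder ι]

variable {𝒱} in
/-- The projection from the tuples to the orbit space of `X`. -/
def toOrbit (a : 𝒱.TupleObj) : X.OrbitSpace := a.2.1.proj

variable {𝒱} in
theorem toOrbit_mem (a : 𝒱.TupleObj) : toOrbit a ∈ 𝒱.V a.1 := a.2.2

theorem continuous_toOrbit : Continuous (toOrbit : 𝒱.TupleObj → X.OrbitSpace) :=
  continuous_sigma fun _ => Tuple.continuous_proj.comp continuous_subtype_val

/-- Two tuples agree on `K` if their indices contain `K` and their projections to `K`-tuples are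
equal. -/
def Agree (K : IndexSet ι) (a b : 𝒱.TupleObj) : Prop :=
  ∃ (ha : K.1 ⊆ a.1.1) (hb : K.1 ⊆ b.1.1), a.2.1.restrict ha = b.2.1.restrict hb

variable {𝒱} {K K' : IndexSet ι} {a b c : 𝒱.TupleObj}

theorem Agree.symm (h : 𝒱.Agree K a b) : 𝒱.Agree K b a :=
  ⟨h.2.1, h.1, h.2.2.symm⟩

theorem Agree.trans (h : 𝒱.Agree K a b) (h' : 𝒱.Agree K b c) : 𝒱.Agree K a c :=
  ⟨h.1, h'.2.1, h.2.2.trans h'.2.2⟩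

theorem Agree.refl (h : K.1 ⊆ a.1.1) : 𝒱.Agree K a a := ⟨h, h, rfl⟩

theorem Agree.mono (h : 𝒱.Agree K a b) (hK : K'.1 ⊆ K.1) : 𝒱.Agree K' a b :=
  ⟨hK.trans h.1, hK.trans h.2.1, congrArg (Tuple.restrict hK) h.2.2⟩

theorem Agree.toOrbit_eq (h : 𝒱.Agree K a b) : toOrbit a = toOrbit b := by
  have := congrArg Tuple.proj h.2.2
  rwa [Tuple.proj_restrict, Tuple.proj_restrict] at this

theorem Agree.obj_eq (h : 𝒱.Agree K a b) {k : ι} (hk : k ∈ K.1) :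
    a.2.1.obj ⟨k, h.1 hk⟩ = b.2.1.obj ⟨k, h.2.1 hk⟩ :=
  congrArg (fun z : Tuple A K => z.obj ⟨k, hk⟩) h.2.2

theorem Agree.mor_eq (h : 𝒱.Agree K a b) {k l : ι} (hk : k ∈ K.1) (hl : l ∈ K.1) :
    a.2.1.mor ⟨k, h.1 hk⟩ ⟨l, h.1 hl⟩ = b.2.1.mor ⟨k, h.2.1 hk⟩ ⟨l, h.2.1 hl⟩ := by
  have := congrArg (fun z : Tuple A K => z.mor ⟨k, hk⟩ ⟨l, hl⟩) h.2.2
  simpa using this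

theorem low_subset_fst (a : 𝒱.TupleObj) : (𝒱.low (toOrbit a)).1 ⊆ a.1.1 :=
  𝒱.low_subset (toOrbit_mem a)

theorem clow_subset_fst (a : 𝒱.TupleObj) : (𝒱.clow (toOrbit a)).1 ⊆ a.1.1 :=
  𝒱.clow_subset_of_mem (toOrbit_mem a)

/-- The common restriction lies over |V_K|, so it is itself an object to which both tuples project.
-/
theorem eqvGen_of_agree (h : 𝒱.Agree K a b) (hK : toOrbit a ∈ 𝒱.V K) :
    Relation.EqvGen 𝒱.Step a b := by
  let c : 𝒱.TupleObj := ⟨K, a.2.1.restrict h.1, by rwa [Tuple.proj_restrict]⟩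
  have h1 : 𝒱.Step a c := ⟨h.1, rfl⟩
  have h2 : 𝒱.Step b c := ⟨h.2.1, h.2.2.symm⟩
  exact (Relation.EqvGen.rel _ _ h1).trans _ _ _ (Relation.EqvGen.rel _ _ h2).symm

/-- The image in |X|, and with it `low`, is constant along a chain of generators. Every object over
w has an index set containing `low w`, and each generator preserves the restriction to it. -/
theorem eqvGen_iff : Relation.EqvGen 𝒱.Step a b ↔ 𝒱.Agree (𝒱.low (toOrbit a)) a b := by
  refine ⟨fun h => ?_, fun h => eqvGen_of_agree h (𝒱.mem_low _)⟩
  induction h with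
  | rel a b h =>
    obtain ⟨h, hab⟩ := h
    have h1 : toOrbit a = toOrbit b := by
      rw [toOrbit, toOrbit, ← hab, Tuple.proj_restrict]
    have h2 : (𝒱.low (toOrbit a)).1 ⊆ b.1.1 := h1 ▸ low_subset_fst b
    exact ⟨h2.trans h, h2, by rw [← hab]; rfl⟩
  | refl a => exact Agree.refl (low_subset_fst a)
  | symm a b _ ih => exact ih.toOrbit_eq ▸ ih.symm
  | trans a b c _ _ ih ih' => exact ih.trans (ih.toOrbit_eq ▸ ih')

theorem groupoid_proj_eq_iff {a b : 𝒱.TupleObj} :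
    𝒱.groupoid.proj a = 𝒱.groupoid.proj b ↔ Relation.EqvGen 𝒱.Step a b := by
  refine proj_eq_iff.trans ⟨?_, fun h => ⟨⟨(a, b), h⟩, rfl, rfl⟩⟩
  rintro ⟨⟨⟨a', b'⟩, h⟩, rfl, rfl⟩
  exact h

theorem projH_eq_of_proj_eq {a b : 𝒱.TupleObj} (h : 𝒱.groupoid.proj a = 𝒱.groupoid.proj b) :
    𝒱.groupoid.projH a = 𝒱.groupoid.projH b := congrArg T2Quotient.mk h

/-! ### The maximal Hausdorff quotient of the orbit space -/

/-- Disjoint neighbourhoods of the two images cannot exist: arbitrarily near the two tuples there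
are equivalent ones, lying over |V_K| with K the smallest index set for closures. -/
theorem projH_eq_of_agree (h : 𝒱.Agree (𝒱.clow (toOrbit a)) a b) :
    𝒱.groupoid.projH a = 𝒱.groupoid.projH b := by
  by_contra hne
  obtain ⟨Oa, Ob, hOa, hOb, haO, hbO, hdisj⟩ := t2_separation hne
  obtain ⟨I, x, hx⟩ := a
  obtain ⟨J, y, hy⟩ := b
  obtain ⟨h1, h2, h3⟩ := h
  set K := 𝒱.clow (toOrbit (⟨I, x, hx⟩ : 𝒱.TupleObj))
  have hopen {L : IndexSet ι} {z : Tuple A L} (hz : z.proj ∈ 𝒱.V L)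
      {O : Set 𝒱.groupoid.HausdorffOrbitSpace} (hO : IsOpen O)
      (hzO : 𝒱.groupoid.projH (⟨L, z, hz⟩ : 𝒱.TupleObj) ∈ O) :
      {z' : Tuple A L | ∃ h : z'.proj ∈ 𝒱.V L,
        𝒱.groupoid.projH (⟨L, z', h⟩ : 𝒱.TupleObj) ∈ O} ∈ 𝓝 z := by
    have h4 : Continuous fun z' : {z' : Tuple A L // z'.proj ∈ 𝒱.V L} =>
        𝒱.groupoid.projH (⟨L, z'⟩ : 𝒱.TupleObj) :=
      isQuotientMap_projH.continuous.comp continuous_sigmaMk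
    have h5 := h4.continuousAt.preimage_mem_nhds (x := ⟨z, hz⟩) (hO.mem_nhds hzO)
    have h6 := ((𝒱.isOpen L).preimage Tuple.continuous_proj).isOpenMap_subtype_val.image_mem_nhds h5
    filter_upwards [h6]
    rintro _ ⟨⟨z', hz'⟩, h7, rfl⟩
    exact ⟨hz', h7⟩
  have h4 := (Tuple.isLocalHomeomorph_restrict h1).isOpenMap.image_mem_nhds (hopen hx hOa haO)
  have h5 := (Tuple.isLocalHomeomorph_restrict h2).isOpenMap.image_mem_nhds (hopen hy hOb hbO)
  dsimp only at h3 h4 h5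
  rw [← h3] at h5
  -- The K-tuples that lift near both given tuples cover a neighbourhood of w in |X|. Since w ∈
  -- cl|V_K|, this neighbourhood meets |V_K|, where agreement on K is equivalence.
  have h6 := Tuple.isOpenMap_proj.image_mem_nhds (inter_mem h4 h5)
  rw [Tuple.proj_restrict] at h6
  obtain ⟨_, ⟨z, ⟨⟨x', ⟨hx', hx'O⟩, rfl⟩, ⟨y', ⟨hy', hy'O⟩, hxy⟩⟩, rfl⟩, h7⟩ :=
    mem_closure_iff_nhds.1 (𝒱.mem_clow _) _ h6
  rw [Tuple.proj_restrict] at h7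
  have h8 : 𝒱.Agree K (⟨I, x', hx'⟩ : 𝒱.TupleObj) ⟨J, y', hy'⟩ := ⟨h1, h2, hxy.symm⟩
  have h9 := projH_eq_of_proj_eq (groupoid_proj_eq_iff.2 (eqvGen_of_agree h8 h7))
  exact disjoint_left.1 hdisj hx'O (h9 ▸ hy'O)

theorem isOpen_restrict_preimage (𝒱 : CompatibleCover A) {K : IndexSet ι} {N : Set X.OrbitSpace}
    (hN : IsOpen N) {T : Set (Tuple A K)} (hT : IsOpen T) :
    IsOpen {c : 𝒱.TupleObj | toOrbit c ∈ N ∧ ∃ h : K.1 ⊆ c.1.1, c.2.1.restrict h ∈ T} := by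
  refine (hN.preimage 𝒱.continuous_toOrbit).inter (isOpen_sigma_iff.2 fun I => ?_)
  by_cases hK : K.1 ⊆ I.1
  · convert hT.preimage ((Tuple.continuous_restrict hK).comp
      (continuous_subtype_val (p := fun x : Tuple A I => x.proj ∈ 𝒱.V I))) using 1
    ext z
    exact ⟨fun h => h.2, fun h => ⟨hK, h⟩⟩
  · convert isOpen_empty
    ext z
    exact ⟨fun h => hK h.1, fun h => h.elim⟩

/-- Two tuples are equivalent if they agree on the smallest index set `K` such that the closure of
`|V_K|` contains their image in the orbit space. -/
def closureSetoid (𝒱 : CompatibleCover A) : Setoid 𝒱.TupleObj where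
  r a b := 𝒱.Agree (𝒱.clow (toOrbit a)) a b
  iseqv :=
    { refl := fun a => Agree.refl (clow_subset_fst a)
      symm := fun h => h.toOrbit_eq ▸ h.symm
      trans := fun h h' => h.trans (h.toOrbit_eq ▸ h') }

/-- Tuples over different points are separated in |X|. Over the same w, their distinct restrictions
to K = `clow w` are separated among K-tuples; the preimages are saturated near w because equivalent
tuples there agree on a set containing K. -/
theorem t2Space_quotient_closureSetoid [T2Space X.OrbitSpace] (𝒱 : CompatibleCover A) :
    T2Space (Quotient 𝒱.closureSetoid) := by
  have hsep : ∀ Oa Ob : Set 𝒱.TupleObj, IsOpen Oa → IsOpen Ob → Disjoint Oa Ob →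
      (∀ c c', 𝒱.closureSetoid c c' → c ∈ Oa → c' ∈ Oa) →
      (∀ c c', 𝒱.closureSetoid c c' → c ∈ Ob → c' ∈ Ob) → ∀ a ∈ Oa, ∀ b ∈ Ob,
      ∃ u v : Set (Quotient 𝒱.closureSetoid), IsOpen u ∧ IsOpen v ∧
        Quotient.mk _ a ∈ u ∧ Quotient.mk _ b ∈ v ∧ Disjoint u v := by
    intro Oa Ob hOa hOb hdisj hsa hsb a ha b hb
    have key : ∀ O : Set 𝒱.TupleObj, IsOpen O → (∀ c c', 𝒱.closureSetoid c c' → c ∈ O → c' ∈ O) →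
        Quotient.mk 𝒱.closureSetoid ⁻¹' (Quotient.mk 𝒱.closureSetoid '' O) = O := by
      intro O hO hs
      refine Subset.antisymm ?_ (subset_preimage_image _ _)
      rintro c ⟨c', hc', hcc'⟩
      exact hs _ _ (Quotient.exact hcc') hc'
    refine ⟨Quotient.mk _ '' Oa, Quotient.mk _ '' Ob, ?_, ?_, mem_image_of_mem _ ha,
      mem_image_of_mem _ hb, ?_⟩
    · rw [← isQuotientMap_quotient_mk'.isOpen_preimage]
      exact (key Oa hOa hsa).symm ▸ hOa
    · rw [← isQuotientMap_quotient_mk'.isOpen_preimage]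
      exact (key Ob hOb hsb).symm ▸ hOb
    · rw [disjoint_left]
      rintro _ ⟨c, hc, rfl⟩ ⟨c', hc', hcc'⟩
      exact disjoint_left.1 hdisj hc (hsb _ _ (Quotient.exact hcc') hc')
  refine ⟨fun p q => Quotient.inductionOn₂ p q fun a b hne => ?_⟩
  by_cases hw : toOrbit a = toOrbit b
  · set w := toOrbit a with hwdef
    obtain ⟨N, hN, hNo, hwN⟩ := eventually_nhds_iff.1 (𝒱.eventually_clow_subset w)
    set K := 𝒱.clow w
    have ha : K.1 ⊆ a.1.1 := clow_subset_fst a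
    have hb : K.1 ⊆ b.1.1 := by
      have := clow_subset_fst b
      rwa [← hw] at this
    have hne' : a.2.1.restrict ha ≠ b.2.1.restrict hb := fun h =>
      hne (Quotient.sound (s := 𝒱.closureSetoid) ⟨ha, hb, h⟩)
    obtain ⟨Ta, Tb, hTa, hTb, haT, hbT, hdisj⟩ := t2_separation hne'
    have hsat : ∀ T : Set (Tuple A K), ∀ c c', 𝒱.closureSetoid c c' →
        c ∈ {c : 𝒱.TupleObj | toOrbit c ∈ N ∧ ∃ h : K.1 ⊆ c.1.1, c.2.1.restrict h ∈ T} →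
        c' ∈ {c : 𝒱.TupleObj | toOrbit c ∈ N ∧ ∃ h : K.1 ⊆ c.1.1, c.2.1.restrict h ∈ T} := by
      rintro T c c' hcc' ⟨hcN, h, hcT⟩
      have h1 : 𝒱.Agree K c c' := Agree.mono hcc' (hN _ hcN)
      refine ⟨h1.toOrbit_eq ▸ hcN, h1.2.1, ?_⟩
      rw [← h1.2.2]
      exact hcT
    refine hsep _ _ (isOpen_restrict_preimage 𝒱 hNo hTa) (isOpen_restrict_preimage 𝒱 hNo hTb) ?_
      (hsat Ta) (hsat Tb) a ⟨hwN, ha, haT⟩ b ⟨hw ▸ hwN, hb, hbT⟩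
    rw [disjoint_left]
    rintro c ⟨-, h, hc⟩ ⟨-, h', hc'⟩
    exact disjoint_left.1 hdisj hc hc'
  · obtain ⟨Oa, Ob, hOa, hOb, haO, hbO, hdisj⟩ := t2_separation hw
    exact hsep _ _ (hOa.preimage 𝒱.continuous_toOrbit) (hOb.preimage 𝒱.continuous_toOrbit)
      (hdisj.preimage _) (fun c c' h hc => by rwa [mem_preimage, ← Agree.toOrbit_eq h])
      (fun c c' h hc => by rwa [mem_preimage, ← Agree.toOrbit_eq h]) a haO b hbO

/-- The quotient by agreement on `clow` is Hausdorff and coarser than the orbit space (as `clow ⊆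
low`), so it factors through the maximal Hausdorff quotient. -/
theorem projH_eq_iff [T2Space X.OrbitSpace] {a b : 𝒱.TupleObj} :
    𝒱.groupoid.projH a = 𝒱.groupoid.projH b ↔ 𝒱.Agree (𝒱.clow (toOrbit a)) a b := by
  refine ⟨fun h => ?_, projH_eq_of_agree⟩
  have := 𝒱.t2Space_quotient_closureSetoid
  let f : 𝒱.groupoid.OrbitSpace → Quotient 𝒱.closureSetoid :=
    Quotient.lift (fun a : 𝒱.TupleObj => Quotient.mk 𝒱.closureSetoid a) fun a b hab =>
      Quotient.sound (s := 𝒱.closureSetoid) ((eqvGen_iff.1 (groupoid_proj_eq_iff.1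
        (Quotient.sound (s := 𝒱.groupoid.orbitSetoid) hab))).mono (𝒱.clow_subset_low _))
  have hf : Continuous f :=
    Continuous.quotient_lift (s := 𝒱.groupoid.orbitSetoid)
      (continuous_quotient_mk' (s := 𝒱.closureSetoid)) _
  have h1 := congrArg (T2Quotient.lift hf) h
  exact Quotient.exact (s := 𝒱.closureSetoid) h1

end CompatibleCover
end Orbi
end

noncomputable section
namespace Orbi

open TopGroupoid

/-- The element `k` of `I`, or the first element of `I` if `k` does not belong to `I`. -/
def IndexSet.orFirst {ι : Type u} [LinearOrder ι] (I : IndexSet ι) (k : ι) : I.1 :=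
  if h : k ∈ I.1 then ⟨k, h⟩ else I.first

theorem IndexSet.orFirst_of_mem {ι : Type u} [LinearOrder ι] {I : IndexSet ι} {k : ι}
    (h : k ∈ I.1) : I.orFirst k = ⟨k, h⟩ := dif_pos h

namespace CompatibleCover

variable {d : ℕ} {X : TopGroupoid.{u}} [SSEStructure d X] {ι : Type u} [LinearOrder ι]
  {A : GoodAtlas d X ι} {𝒱 : CompatibleCover A}

/-! ### Neighbourhoods of tuples -/

theorem tuple_mem_nhds {I : IndexSet ι} {z : Tuple A I} (hz : z.proj ∈ 𝒱.V I)
    {O : Set 𝒱.TupleObj} (hO : O ∈ 𝓝 (⟨I, z, hz⟩ : 𝒱.TupleObj)) :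
    {z' : Tuple A I | ∃ h : z'.proj ∈ 𝒱.V I, (⟨I, z', h⟩ : 𝒱.TupleObj) ∈ O} ∈ 𝓝 z := by
  have h4 := continuous_sigmaMk (σ := fun I => {z' : Tuple A I // z'.proj ∈ 𝒱.V I}) (i := I)
  have h5 := h4.continuousAt.preimage_mem_nhds (x := ⟨z, hz⟩) hO
  filter_upwards [((𝒱.isOpen I).preimage
    Tuple.continuous_proj).isOpenMap_subtype_val.image_mem_nhds h5]
  rintro _ ⟨⟨z', hz'⟩, h7, rfl⟩
  exact ⟨hz', h7⟩

/-- The object with index `k` in a tuple. -/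
def objAt (k : ι) (a : 𝒱.TupleObj) : X.Obj := a.2.1.obj (a.1.orFirst k)

/-- The morphism in a tuple from the first object to the one with index `k`. -/
def morAt (k : ι) (a : 𝒱.TupleObj) : X.Mor := a.2.1.mor a.1.first (a.1.orFirst k)

/-- The first object in a tuple. -/
def firstObj (a : 𝒱.TupleObj) : X.Obj := a.2.1.obj a.1.first

theorem src_morAt (k : ι) (a : 𝒱.TupleObj) : X.src (morAt k a) = firstObj a := Tuple.src_mor ..

theorem tgt_morAt (k : ι) (a : 𝒱.TupleObj) : X.tgt (morAt k a) = objAt k a := Tuple.tgt_mor ..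

theorem objAt_of_mem {k : ι} {a : 𝒱.TupleObj} (h : k ∈ a.1.1) :
    objAt k a = a.2.1.obj ⟨k, h⟩ := by rw [objAt, IndexSet.orFirst_of_mem h]

theorem morAt_of_mem {k : ι} {a : 𝒱.TupleObj} (h : k ∈ a.1.1) :
    morAt k a = a.2.1.mor a.1.first ⟨k, h⟩ := by rw [morAt, IndexSet.orFirst_of_mem h]

theorem continuous_morAt (k : ι) : Continuous (morAt k : 𝒱.TupleObj → X.Mor) :=
  continuous_sigma fun I => (Tuple.continuous_mor I.first (I.orFirst k)).comp continuous_subtype_val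

theorem Agree.objAt_eq {K : IndexSet ι} {a b : 𝒱.TupleObj} (h : 𝒱.Agree K a b) {k : ι}
    (hk : k ∈ K.1) : objAt k a = objAt k b := by
  rw [objAt_of_mem (h.1 hk), objAt_of_mem (h.2.1 hk), h.obj_eq hk]

theorem exists_injOn_objAt (a : 𝒱.TupleObj) : ∃ T ∈ 𝓝 a, (∀ b ∈ T, b.1 = a.1) ∧
    ∀ k ∈ a.1.1, InjOn (objAt k) T := by
  obtain ⟨I, z, hz⟩ := a
  obtain ⟨T, hT, hinj⟩ := Tuple.exists_injOn_obj z
  have h1 : Sigma.mk I '' (Subtype.val ⁻¹' T) ∈ 𝓝 (⟨I, z, hz⟩ : 𝒱.TupleObj) :=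
    isOpenMap_sigmaMk.image_mem_nhds (continuous_subtype_val.continuousAt hT)
  refine ⟨_, h1, ?_, fun k hk => ?_⟩
  · rintro _ ⟨b, -, rfl⟩
    rfl
  · rintro _ ⟨b, hb, rfl⟩ _ ⟨c, hc, rfl⟩ hbc
    rw [Subtype.ext (hinj _ hb hc hbc)]

theorem isLocalHomeomorph_firstObj :
    IsLocalHomeomorph (firstObj : 𝒱.TupleObj → X.Obj) := by
  refine isLocalHomeomorph_of_isOpenMap
    (continuous_sigma fun I => (Tuple.continuous_obj I.first).comp continuous_subtype_val)
    (isOpenMap_sigma.2 fun I => (Tuple.isOpenMap_obj I.first).comp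
      ((𝒱.isOpen I).preimage Tuple.continuous_proj).isOpenMap_subtype_val) fun a => ?_
  obtain ⟨T, hT, h1, h2⟩ := exists_injOn_objAt a
  refine ⟨T, hT, fun b hb c hc hbc => h2 _ a.1.first.2 hb hc ?_⟩
  have h3 : ∀ b ∈ T, objAt a.1.first.1 b = firstObj b := by
    rintro ⟨I, z⟩ hb
    obtain rfl : I = a.1 := h1 _ hb
    exact objAt_of_mem (𝒱 := 𝒱) (a := ⟨a.1, z⟩) a.1.first.2
  rw [h3 b hb, h3 c hc, hbc]

/-- Near the common restriction, a K-tuple is determined by any one of its objects, and agreement on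
L supplies a common object. -/
theorem eventually_agree {K : IndexSet ι} {a b : 𝒱.TupleObj} (h : 𝒱.Agree K a b) :
    ∀ᶠ p : 𝒱.TupleObj × 𝒱.TupleObj in 𝓝 (a, b), ∀ L : IndexSet ι, L.1 ⊆ K.1 →
      𝒱.Agree L p.1 p.2 → 𝒱.Agree K p.1 p.2 := by
  obtain ⟨ha, hb, hab⟩ := h
  obtain ⟨T, hT, hinj⟩ := Tuple.exists_injOn_obj (a.2.1.restrict ha)
  have hO := isOpen_restrict_preimage 𝒱 isOpen_univ (isOpen_interior (s := T))
  have h1 := hO.mem_nhds (x := a) ⟨mem_univ _, ha, mem_interior_iff_mem_nhds.2 hT⟩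
  have h2 := hO.mem_nhds (x := b) ⟨mem_univ _, hb, mem_interior_iff_mem_nhds.2 (hab ▸ hT)⟩
  filter_upwards [prod_mem_nhds h1 h2]
  rintro ⟨a', b'⟩ ⟨⟨-, ha', haT⟩, ⟨-, hb', hbT⟩⟩ L hL hLab
  exact ⟨ha', hb', hinj ⟨L.first.1, hL L.first.2⟩ (interior_subset haT) (interior_subset hbT)
    (hLab.obj_eq L.first.2)⟩

/-! ### The groupoid of a cover is étale -/

/-- Openness: if a and b agree on K = `low`, the K-restriction of a tuple near a lifts to a tuple
near b. Injectivity: the target has a prescribed object with index in K, and near b this object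
determines it. -/
theorem isLocalHomeomorph_groupoid_src : IsLocalHomeomorph 𝒱.groupoid.src := by
  refine isLocalHomeomorph_of_isOpenMap 𝒱.groupoid.continuous_src
    (IsOpenMap.of_nhds_le ?_) ?_
  · rintro ⟨⟨a, b⟩, h⟩ T hT
    rw [mem_map] at hT
    obtain ⟨S, hS, hST⟩ := mem_nhds_induced _ _ _ |>.1 hT
    obtain ⟨Oa, hOa, Ob, hOb, hO⟩ := mem_nhds_prod_iff.1 hS
    obtain ⟨ha, hb, hab⟩ := eqvGen_iff.1 h
    set K := 𝒱.low (toOrbit a)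
    have h1 := (Tuple.isLocalHomeomorph_restrict hb).isOpenMap.image_mem_nhds
      (tuple_mem_nhds b.2.2 hOb)
    dsimp only at h1 hab
    rw [← hab] at h1
    have h2 := (isOpen_restrict_preimage 𝒱 (𝒱.isOpen K) isOpen_interior).mem_nhds
      (x := a) ⟨𝒱.mem_low _, ha, mem_interior_iff_mem_nhds.2 h1⟩
    change T ∈ 𝓝 a
    filter_upwards [h2, hOa]
    rintro a' ⟨haV, ha', h3⟩ haO
    obtain ⟨y, ⟨hy, hyO⟩, hya⟩ := interior_subset h3
    have h4 : 𝒱.Agree K a' ⟨b.1, y, hy⟩ := ⟨ha', hb, hya.symm⟩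
    exact @hST ⟨(a', ⟨b.1, y, hy⟩), eqvGen_of_agree h4 haV⟩ (hO ⟨haO, hyO⟩)
  · rintro ⟨⟨a, b⟩, h⟩
    obtain ⟨T, hT, h1, h2⟩ := exists_injOn_objAt b
    refine ⟨𝒱.groupoid.tgt ⁻¹' T, 𝒱.groupoid.continuous_tgt.continuousAt hT, ?_⟩
    rintro ⟨⟨a', b'⟩, h'⟩ hb' ⟨⟨a'', b''⟩, h''⟩ hb'' (rfl : a' = a'')
    have h3 := eqvGen_iff.1 h'
    have h4 := eqvGen_iff.1 h''
    set K := 𝒱.low (toOrbit a')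
    change b' ∈ T at hb'
    change b'' ∈ T at hb''
    have h5 : b' = b'' := h2 K.first.1 (h1 b' hb' ▸ h3.2.1 K.first.2) hb' hb''
      ((h3.objAt_eq K.first.2).symm.trans (h4.objAt_eq K.first.2))
    subst h5
    rfl

/-! ### The projection to the given groupoid -/

/-- The morphism between the first objects of two tuples with the same object with index `k`. -/
def transMor (k : ι) (a b : 𝒱.TupleObj) (h : objAt k a = objAt k b) : X.Mor :=
  X.comp (X.inv (morAt k b)) (morAt k a) (by rw [X.src_inv, tgt_morAt, tgt_morAt, h])

theorem src_transMor {k : ι} {a b : 𝒱.TupleObj} (h : objAt k a = objAt k b) :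
    X.src (transMor k a b h) = firstObj a := by
  rw [transMor, X.src_comp, src_morAt]

theorem tgt_transMor {k : ι} {a b : 𝒱.TupleObj} (h : objAt k a = objAt k b) :
    X.tgt (transMor k a b h) = firstObj b := by
  rw [transMor, X.tgt_comp, X.tgt_inv, src_morAt]

theorem transMor_self (k : ι) (a : 𝒱.TupleObj) :
    transMor k a a rfl = X.one (firstObj a) := by
  rw [transMor, X.inv_comp, src_morAt]

theorem comp_transMor {k : ι} {a b c : 𝒱.TupleObj} (h : objAt k a = objAt k b)
    (h' : objAt k b = objAt k c) (H : X.src (transMor k b c h') = X.tgt (transMor k a b h)) :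
    X.comp (transMor k b c h') (transMor k a b h) H = transMor k a c (h.trans h') := by
  have h1 : X.src (morAt k b) = X.tgt (transMor k a b h) := by rw [src_morAt, tgt_transMor]
  have h2 : X.src (X.inv (morAt k c)) = X.tgt (morAt k b) := by
    rw [X.src_inv, tgt_morAt, tgt_morAt, h']
  have h3 : X.src (X.inv (morAt k b)) = X.tgt (morAt k a) := by
    rw [X.src_inv, tgt_morAt, tgt_morAt, h]
  refine (X.assoc (X.inv (morAt k c)) (morAt k b) (transMor k a b h) h2 h1).trans ?_
  refine X.comp_congr _ rfl ?_
  refine (X.assoc (morAt k b) (X.inv (morAt k b)) (morAt k a) (X.tgt_inv _).symm h3).symm.trans ?_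
  rw [X.comp_congr _ (X.comp_inv _) rfl, X.one_comp']

/-- Crossing at l instead of k inserts the morphism from k to l in a and its inverse in b; by
agreement these cancel. -/
theorem Agree.transMor_eq {K : IndexSet ι} {a b : 𝒱.TupleObj} (h : 𝒱.Agree K a b) {k l : ι}
    (hk : k ∈ K.1) (hl : l ∈ K.1) :
    transMor k a b (h.objAt_eq hk) = transMor l a b (h.objAt_eq hl) := by
  have key : ∀ (c : 𝒱.TupleObj) (hk : k ∈ c.1.1) (hl : l ∈ c.1.1),
      ∃ H, morAt l c = X.comp (c.2.1.mor ⟨k, hk⟩ ⟨l, hl⟩) (morAt k c) H := by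
    intro c hk hl
    refine ⟨by rw [tgt_morAt, Tuple.src_mor, objAt_of_mem hk], ?_⟩
    rw [X.comp_congr _ rfl (morAt_of_mem hk), Tuple.mor_comp, morAt_of_mem hl]
  obtain ⟨h1, h2⟩ := key a (h.1 hk) (h.1 hl)
  obtain ⟨h3, h4⟩ := key b (h.2.1 hk) (h.2.1 hl)
  have h5 : X.src (morAt l b) = X.tgt (transMor k a b (h.objAt_eq hk)) := by
    rw [src_morAt, tgt_transMor]
  have h6 : X.tgt (morAt l a) = X.tgt (morAt l b) := by
    rw [tgt_morAt, tgt_morAt, h.objAt_eq hl]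
  refine X.comp_left_cancel (δ := morAt l b) (h := h5)
    (h' := by rw [src_morAt, tgt_transMor]) ?_
  have h7 : X.comp (morAt l b) (transMor l a b (h.objAt_eq hl))
      (by rw [src_morAt, tgt_transMor]) = morAt l a := by
    refine (X.assoc (morAt l b) (X.inv (morAt l b)) (morAt l a) (X.tgt_inv _).symm
      (by rw [X.src_inv, h6])).symm.trans ?_
    rw [X.comp_congr _ (X.comp_inv _) rfl, X.one_comp']
  have h8 : X.comp (morAt k b) (transMor k a b (h.objAt_eq hk))
      (by rw [src_morAt, tgt_transMor]) = morAt k a := by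
    refine (X.assoc (morAt k b) (X.inv (morAt k b)) (morAt k a) (X.tgt_inv _).symm
      (by rw [X.src_inv, tgt_morAt, tgt_morAt, h.objAt_eq hk])).symm.trans ?_
    rw [X.comp_congr _ (X.comp_inv _) rfl, X.one_comp']
  rw [h7, X.comp_congr _ h4 rfl, X.assoc _ _ _ h3 (by rw [src_morAt, tgt_transMor]),
    X.comp_congr _ rfl h8, h2]
  exact X.comp_congr _ (h.mor_eq hk hl).symm rfl

/-- The smallest index in the smallest `K` such that `|V_K|` contains the image of a tuple. -/
def lowIndex (a : 𝒱.TupleObj) : ι := (𝒱.low (toOrbit a)).first.1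

/-- The projection of the groupoid of a cover to `X`, on morphisms. -/
def projMor (γ : 𝒱.groupoid.Mor) : X.Mor :=
  transMor (lowIndex γ.1.1) γ.1.1 γ.1.2
    ((eqvGen_iff.1 γ.2).objAt_eq (𝒱.low (toOrbit γ.1.1)).first.2)

/-- The index set used for crossing may be any K of agreement with the point in |V_K|. Composable or
nearby morphisms can thus be computed with one common index, which gives functoriality and
continuity. -/
theorem projMor_eq {K : IndexSet ι} {γ : 𝒱.groupoid.Mor} (h : 𝒱.Agree K γ.1.1 γ.1.2)
    (hK : toOrbit γ.1.1 ∈ 𝒱.V K) {k : ι} (hk : k ∈ K.1) :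
    projMor γ = transMor k γ.1.1 γ.1.2 (h.objAt_eq hk) :=
  h.transMor_eq (𝒱.low_subset hK (𝒱.low (toOrbit γ.1.1)).first.2) hk

theorem continuous_projMor : Continuous (projMor : 𝒱.groupoid.Mor → X.Mor) := by
  refine continuous_iff_continuousAt.2 fun γ T hT => ?_
  have h1 := eqvGen_iff.1 γ.2
  set K := 𝒱.low (toOrbit γ.1.1) with hK
  have hpair : Continuous fun γ' : 𝒱.groupoid.Mor => γ'.1 := continuous_subtype_val
  have ha : Continuous fun γ' : 𝒱.groupoid.Mor => γ'.1.1 := continuous_fst.comp hpair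
  have hb : Continuous fun γ' : 𝒱.groupoid.Mor => γ'.1.2 := continuous_snd.comp hpair
  rw [projMor_eq h1 (𝒱.mem_low _) K.first.2] at hT
  have h2 := eventually_comp_mem _ hT
  have h3 : Continuous fun γ' : 𝒱.groupoid.Mor =>
      (X.inv (morAt K.first.1 γ'.1.2), morAt K.first.1 γ'.1.1) :=
    (X.continuous_inv.comp ((continuous_morAt _).comp hb)).prodMk ((continuous_morAt _).comp ha)
  have h4 := (h3.continuousAt (x := γ)).eventually h2
  have h5 := (hpair.continuousAt (x := γ)).eventually (eventually_agree h1)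
  have h6 := ((𝒱.continuous_toOrbit.comp ha).continuousAt (x := γ)).eventually
    ((𝒱.isOpen K).mem_nhds (𝒱.mem_low _))
  change ∀ᶠ γ' in 𝓝 γ, projMor γ' ∈ T
  filter_upwards [h4, h5, h6] with γ' h7 h8 h9
  have h10 : 𝒱.Agree K γ'.1.1 γ'.1.2 := h8 _ (𝒱.low_subset h9) (eqvGen_iff.1 γ'.2)
  rw [projMor_eq h10 h9 K.first.2]
  exact h7 _

variable (𝒱) in
/-- The projection of the groupoid of a cover to `X`. -/
def projHom : 𝒱.groupoid.Hom X where
  obj := firstObj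
  mor := projMor
  src_mor _ := src_transMor _
  tgt_mor _ := tgt_transMor _
  mor_one a := transMor_self _ _
  mor_comp := by
    rintro ⟨⟨b', c⟩, hδ⟩ ⟨⟨a, b⟩, hγ⟩ (rfl : b' = b)
    have h1 := eqvGen_iff.1 hγ
    have h2 : 𝒱.Agree (𝒱.low (toOrbit a)) b' c := h1.toOrbit_eq ▸ eqvGen_iff.1 hδ
    set K := 𝒱.low (toOrbit a)
    have e1 := projMor_eq (γ := ⟨(a, b'), hγ⟩) h1 (𝒱.mem_low _) K.first.2
    have e2 := projMor_eq (γ := ⟨(b', c), hδ⟩) h2 (h1.toOrbit_eq ▸ 𝒱.mem_low _) K.first.2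
    have e3 := projMor_eq (γ := ⟨(a, c), hγ.trans _ _ _ hδ⟩) (h1.trans h2) (𝒱.mem_low _) K.first.2
    exact (e3.trans (comp_transMor (h1.objAt_eq K.first.2) (h2.objAt_eq K.first.2)
      (by rw [src_transMor, tgt_transMor])).symm).trans (X.comp_congr _ e2.symm e1.symm)

theorem isProjection_projHom : 𝒱.IsProjection 𝒱.projHom := by
  refine ⟨fun a => rfl, fun a b h => ?_⟩
  have h1 : 𝒱.Agree b.1 a b := ⟨h.1, Finset.Subset.refl _, h.2⟩
  refine (projMor_eq (γ := 𝒱.stepMor a b h) h1 (h1.toOrbit_eq ▸ toOrbit_mem b)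
    b.1.first.2).trans ?_
  have h2 : X.inv (morAt b.1.first.1 b) = X.one (firstObj b) := by
    rw [morAt_of_mem b.1.first.2, Tuple.mor_self, X.inv_one]; rfl
  refine (X.comp_congr _ h2 (morAt_of_mem (h.1 b.1.first.2))).trans ?_
  rw [X.one_comp', Tuple.mor_of_le]

/-! ### The smooth structure of the groupoid of a cover -/

theorem secondCountable_tupleObj (𝒱 : CompatibleCover A) : SecondCountableTopology 𝒱.TupleObj := by
  have := A.countable_index
  have (I : IndexSet ι) : SecondCountableTopology {x : Tuple A I // x.proj ∈ 𝒱.V I} :=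
    IsEmbedding.subtypeVal.secondCountableTopology
  infer_instance

theorem secondCountable_mor (𝒱 : CompatibleCover A) : SecondCountableTopology 𝒱.groupoid.Mor := by
  have := 𝒱.secondCountable_tupleObj
  exact (IsEmbedding.subtypeVal (p := fun p : 𝒱.TupleObj × 𝒱.TupleObj =>
    Relation.EqvGen 𝒱.Step p.1 p.2)).secondCountableTopology

theorem t2Space_mor (𝒱 : CompatibleCover A) : T2Space 𝒱.groupoid.Mor :=
  inferInstanceAs (T2Space {p : 𝒱.TupleObj × 𝒱.TupleObj // Relation.EqvGen 𝒱.Step p.1 p.2})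

theorem isNonsingular_groupoid (𝒱 : CompatibleCover A) : 𝒱.groupoid.IsNonsingular := by
  rintro ⟨⟨a, b⟩, h⟩ (rfl : a = b)
  rfl

variable (𝒱) in
/-- The structure of an oriented sse groupoid on the groupoid of a cover for which the projection
is an oriented local diffeomorphism. -/
@[reducible] def sseStructure : SSEStructure d 𝒱.groupoid :=
  letI m₀ : OrientedManifold d 𝒱.groupoid.Obj := OrientedManifold.pullback (p := 𝒱.projHom.obj)
    isLocalHomeomorph_firstObj (inferInstanceAs (T2Space 𝒱.TupleObj)) 𝒱.secondCountable_tupleObj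
  letI m₁ : OrientedManifold d 𝒱.groupoid.Mor := OrientedManifold.pullback
    (isLocalHomeomorph_firstObj.comp isLocalHomeomorph_groupoid_src)
    𝒱.t2Space_mor 𝒱.secondCountable_mor
  have h0 : IsOrientedLocalDiffeo d 𝒱.projHom.obj :=
    OrientedManifold.pullback_isOrientedLocalDiffeo _ _ _
  have h1 : IsOrientedLocalDiffeo d (𝒱.projHom.obj ∘ 𝒱.groupoid.src) :=
    OrientedManifold.pullback_isOrientedLocalDiffeo _ _ _
  -- Only the projection on objects and its composite with the source map are oriented local
  -- diffeomorphisms by construction; the other maps follow by composition and cancellation.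
  have hsrc : IsOrientedLocalDiffeo d 𝒱.groupoid.src := h0.of_comp h1 𝒱.groupoid.continuous_src
  have h2 : X.src ∘ 𝒱.projHom.mor = 𝒱.projHom.obj ∘ 𝒱.groupoid.src :=
    funext fun γ => 𝒱.projHom.src_mor γ
  have h3 : X.tgt ∘ 𝒱.projHom.mor = 𝒱.projHom.obj ∘ 𝒱.groupoid.tgt :=
    funext fun γ => 𝒱.projHom.tgt_mor γ
  have hmor : IsOrientedLocalDiffeo d 𝒱.projHom.mor :=
    (SSEStructure.src_etale (d := d) (X := X)).of_comp (h2 ▸ h1) continuous_projMor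
  have htgt : IsOrientedLocalDiffeo d 𝒱.groupoid.tgt :=
    h0.of_comp (h3 ▸ (SSEStructure.tgt_etale (d := d) (X := X)).comp hmor)
      𝒱.groupoid.continuous_tgt
  have hone : 𝒱.groupoid.src ∘ 𝒱.groupoid.one = fun x => x := funext 𝒱.groupoid.src_one
  have hinv : 𝒱.groupoid.src ∘ 𝒱.groupoid.inv = 𝒱.groupoid.tgt := funext 𝒱.groupoid.src_inv
  { manObj := m₀
    manMor := m₁
    src_etale := hsrc
    tgt_etale := htgt
    one_etale := hsrc.of_comp (hone ▸ isOrientedLocalDiffeo_id) 𝒱.groupoid.continuous_one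
    inv_etale := hsrc.of_comp (hinv ▸ htgt) 𝒱.groupoid.continuous_inv
    stable := fun x => by
      have : Subsingleton (𝒱.groupoid.Stab x) := ⟨fun γ δ => Subtype.ext (by
        rw [𝒱.isNonsingular_groupoid γ.1 (γ.2.1.trans γ.2.2.symm),
          𝒱.isNonsingular_groupoid δ.1 (δ.2.1.trans δ.2.2.symm), γ.2.1, δ.2.1])⟩
      infer_instance }

theorem isOrientedLocalDiffeo_firstObj (𝒱 : CompatibleCover A) :
    letI := 𝒱.sseStructure
    IsOrientedLocalDiffeo d 𝒱.projHom.obj :=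
  OrientedManifold.pullback_isOrientedLocalDiffeo _ _ _

theorem isSmoothFunctor_projHom (𝒱 : CompatibleCover A) :
    letI := 𝒱.sseStructure
    IsSmoothFunctor d 𝒱.projHom := by
  let := 𝒱.sseStructure
  have h0 := 𝒱.isOrientedLocalDiffeo_firstObj
  have h2 : X.src ∘ 𝒱.projHom.mor = 𝒱.projHom.obj ∘ 𝒱.groupoid.src :=
    funext fun γ => 𝒱.projHom.src_mor γ
  have hmor : IsOrientedLocalDiffeo d 𝒱.projHom.mor :=
    (SSEStructure.src_etale (d := d) (X := X)).of_comp
      (h2 ▸ h0.comp (SSEStructure.src_etale (d := d) (X := 𝒱.groupoid))) continuous_projMor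
  exact ⟨h0.1.contMDiff, hmor.1.contMDiff⟩

end CompatibleCover
end Orbi
end

noncomputable section
namespace Orbi

open TopGroupoid

/-! ### Periodic maps that are the identity near a point -/

/-- The orbit sum h = ∑ φᵏ, k < n, satisfies h ∘ φ = h near u and has derivative n · id there. So h
is injective near u and φ(v) = v. -/
theorem eventually_eq_of_iterate {E : Type*} [NormedAddCommGroup E] [NormedSpace ℝ E]
    [CompleteSpace E] {φ : E → E} {u : E} (hφ : HasStrictFDerivAt φ (ContinuousLinearMap.id ℝ E) u)
    (hu : φ u = u) {n : ℕ} (hn : n ≠ 0) (hper : ∀ᶠ v in 𝓝 u, φ^[n] v = v) :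
    ∀ᶠ v in 𝓝 u, φ v = v := by
  let e : E ≃L[ℝ] E := ContinuousLinearEquiv.smulLeft (Units.mk0 (n : ℝ) (by exact_mod_cast hn))
  let h : E → E := fun v => ∑ k ∈ Finset.range n, φ^[k] v
  have hh : HasStrictFDerivAt h (e : E →L[ℝ] E) u := by
    have h1 : HasStrictFDerivAt h
        (∑ k ∈ Finset.range n, (ContinuousLinearMap.id ℝ E) ^ k) u :=
      HasStrictFDerivAt.fun_sum fun k _ => hφ.iterate hu k
    convert h1 using 1
    ext v
    have : (ContinuousLinearMap.id ℝ E) = 1 := rfl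
    simp [this, e, Units.smul_def, Nat.cast_smul_eq_nsmul]
  have hcomp : ∀ᶠ v in 𝓝 u, h (φ v) = h v := by
    filter_upwards [hper] with v hv
    have h1 := Finset.sum_range_succ (fun k => φ^[k] v) n
    rw [Finset.sum_range_succ', hv] at h1
    exact add_right_cancel h1
  have h1 := hh.eventually_left_inverse
  have h2 : Tendsto φ (𝓝 u) (𝓝 u) := by
    have := hφ.continuousAt.tendsto
    rwa [hu] at this
  filter_upwards [hcomp, h1, h2.eventually h1] with v h3 h4 h5
  rw [← h5, h3, h4]

/-- The set where φ is locally the identity is open. At a limit point v ∈ U of it, continuity gives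
φ(v) = v and derivative the identity, so periodicity puts v in the set. -/
theorem eqOn_of_iterate {E : Type*} [NormedAddCommGroup E] [NormedSpace ℝ E]
    [CompleteSpace E] {U : Set E} (hU : IsOpen U) (hUc : IsPreconnected U) {φ : E → E}
    (hφ : ContDiffOn ℝ 1 φ U) {n : ℕ} (hn : n ≠ 0) (hper : ∀ v ∈ U, φ^[n] v = v) {u : E}
    (hu : u ∈ U) (hφu : ∀ᶠ v in 𝓝 u, φ v = v) : ∀ v ∈ U, φ v = v := by
  let S : Set E := {v | ∀ᶠ v' in 𝓝 v, φ v' = v'}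
  have hS : IsOpen S := isOpen_setOfPred_eventually_nhds
  have hsub : U ⊆ S := by
    refine hUc.subset_of_closure_inter_subset hS ⟨u, hu, hφu⟩ ?_
    rintro v ⟨hvS, hvU⟩
    have hat : ContDiffAt ℝ 1 φ v := hφ.contDiffAt (hU.mem_nhds hvU)
    have hfreq : ∃ᶠ v' in 𝓝 v, v' ∈ S := mem_closure_iff_frequently.1 hvS
    have h1 : φ v = v := tendsto_nhds_unique_of_frequently_eq hat.continuousAt.tendsto tendsto_id
      (hfreq.mono fun v' hv' => hv'.self_of_nhds)
    have h2 : ContinuousAt (fderiv ℝ φ) v := (hat.fderiv_right (m := 0) (by simp)).continuousAt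
    have h3 : fderiv ℝ φ v = ContinuousLinearMap.id ℝ E :=
      tendsto_nhds_unique_of_frequently_eq h2.tendsto tendsto_const_nhds
        (hfreq.mono fun v' hv' => by
          rw [Filter.EventuallyEq.fderiv_eq (show φ =ᶠ[𝓝 v'] id from hv')]
          exact fderiv_id)
    have h4 := hat.hasStrictFDerivAt (by simp)
    rw [h3] at h4
    exact eventually_eq_of_iterate h4 h1 hn (by filter_upwards [hU.mem_nhds hvU] using hper)
  exact fun v hv => (hsub hv).self_of_nhds

/-! ### Locally trivial isotropy -/

namespace TopGroupoid

variable {X : TopGroupoid.{u}}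

/-- All morphisms near `γ` are self-morphisms. -/
def IsLocallyTrivial (γ : X.Mor) : Prop := ∀ᶠ γ' in 𝓝 γ, X.src γ' = X.tgt γ'

/-- A morphism ε' near ε is conjugated by δ₁, δ₂ near δ to a morphism near γ, which is a
self-morphism. Hence δ₁ and δ₂ have the same source, so they are equal, and ε' is a self-morphism.
-/
theorem IsLocallyTrivial.conj (d : ℕ) [SSEStructure d X] {δ γ ε : X.Mor}
    {h : X.src ε = X.tgt δ} {h' : X.src δ = X.tgt γ} (H : X.comp ε δ h = X.comp δ γ h')
    (hγ : IsLocallyTrivial γ) : IsLocallyTrivial ε := by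
  have h1 : X.src (X.inv δ) = X.tgt (X.comp ε δ h) := by rw [H, X.tgt_comp, X.src_inv]
  have hγ' : {γ' | X.src γ' = X.tgt γ'} ∈ 𝓝 (X.comp (X.inv δ) (X.comp ε δ h) h1) := by
    rw [X.comp_congr _ rfl H, X.inv_comp_comp]
    exact hγ
  obtain ⟨P, hP, Q, hQ, hPQ⟩ := mem_nhds_prod_iff.1 (eventually_comp_mem h1 hγ')
  obtain ⟨R, hR, S, hS, hRS⟩ := mem_nhds_prod_iff.1 (eventually_comp_mem h hQ)
  obtain ⟨T, hT, hδT, hinj⟩ := (isLocalHomeomorph_src d X).isLocallyInjective δ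
  have h2 : X.inv ⁻¹' P ∩ (S ∩ T) ∈ 𝓝 δ :=
    inter_mem (X.continuous_inv.continuousAt hP) (inter_mem hS (hT.mem_nhds hδT))
  have h3 := (isLocalHomeomorph_tgt d X).isOpenMap.image_mem_nhds h2
  have h4 : X.tgt ε = X.tgt δ := by
    rw [← X.tgt_comp ε δ h, H, X.tgt_comp]
  filter_upwards [hR, X.continuous_src.continuousAt.preimage_mem_nhds (by rwa [h]),
    X.continuous_tgt.continuousAt.preimage_mem_nhds (by rwa [h4])] with ε' h5 h6 h7
  obtain ⟨δ₁, ⟨-, hδ₁S, hδ₁T⟩, h8⟩ := h6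
  obtain ⟨δ₂, ⟨hδ₂P, -, hδ₂T⟩, h9⟩ := h7
  have h10 := hRS (mk_mem_prod h5 hδ₁S) h8.symm
  have h11 := hPQ (mk_mem_prod hδ₂P h10) (by rw [X.src_inv, X.tgt_comp, h9])
  have h12 : X.src δ₁ = X.src δ₂ := by
    have : X.src _ = X.tgt _ := h11
    rwa [X.src_comp, X.tgt_comp, X.src_comp, X.tgt_inv] at this
  rw [← h8, ← h9, hinj hδ₁T hδ₂T h12]

/-- The number of the elements of the stabilizer of `x` that act trivially near `x`. -/
def trivialCard (X : TopGroupoid.{u}) (x : X.Obj) : ℕ :=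
  Nat.card {γ : X.Stab x // IsLocallyTrivial γ.1}

theorem trivialCard_le (d : ℕ) [SSEStructure d X] (δ : X.Mor) :
    X.trivialCard (X.src δ) ≤ X.trivialCard (X.tgt δ) := by
  have := SSEStructure.stable (d := d) (X.tgt δ)
  have h1 (γ : X.Stab (X.src δ)) : X.src δ = X.tgt γ.1 := γ.2.2.symm
  have h2 (γ : X.Stab (X.src δ)) : X.src (X.comp δ γ.1 (h1 γ)) = X.src δ := by
    rw [X.src_comp, γ.2.1]
  refine Nat.card_le_card_of_injective (fun γ => ⟨⟨X.div (X.comp δ γ.1.1 (h1 γ.1)) δ (h2 γ.1),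
    src_div _, by rw [tgt_div, X.tgt_comp]⟩, ?_⟩) fun γ γ' H => ?_
  · exact γ.2.conj d (div_comp (h2 γ.1))
  · have h3 := congrArg (fun ε => ε.1.1) H
    exact Subtype.ext (Subtype.ext (X.comp_left_cancel (X.comp_right_cancel h3)))

theorem trivialCard_eq (d : ℕ) [SSEStructure d X] {x y : X.Obj} (h : X.proj x = X.proj y) :
    X.trivialCard x = X.trivialCard y := by
  obtain ⟨δ, rfl, rfl⟩ := proj_eq_iff.1 h
  refine (trivialCard_le d δ).antisymm ?_
  have := trivialCard_le d (X.inv δ)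
  rwa [X.src_inv, X.tgt_inv] at this

/-- The number of the elements of the stabilizer of a point that act trivially near the point, as
a function on the orbit space. -/
def orbitTrivialCard (X : TopGroupoid.{u}) (p : X.OrbitSpace) : ℕ :=
  X.trivialCard (proj_surjective p).choose

theorem orbitTrivialCard_proj (d : ℕ) [SSEStructure d X] (x : X.Obj) :
    X.orbitTrivialCard (X.proj x) = X.trivialCard x :=
  trivialCard_eq d (proj_surjective (X.proj x)).choose_spec

theorem trivialCard_of_isSmoothPoint {x : X.Obj} (h : X.IsSmoothPoint (X.proj x)) :
    X.trivialCard x = Nat.card (X.Stab x) :=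
  Nat.card_congr (Equiv.subtypeUnivEquiv fun γ => h x rfl γ)

theorem trivialCard_pos (d : ℕ) [SSEStructure d X] (x : X.Obj) : 0 < X.trivialCard x := by
  have := SSEStructure.stable (d := d) x
  refine Nat.card_pos_iff.2 ⟨⟨⟨⟨X.one x, X.src_one x, X.tgt_one x⟩, ?_⟩⟩, inferInstance⟩
  have h := SSEStructure.one_etale (d := d) (X := X)
  have h1 : range X.one ∈ 𝓝 (X.one x) :=
    h.isLocalHomeomorph.isOpenMap.isOpen_range.mem_nhds (mem_range_self x)
  filter_upwards [h1]
  rintro _ ⟨y, rfl⟩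
  rw [X.src_one, X.tgt_one]

theorem orbitTrivialCard_pos (d : ℕ) [SSEStructure d X] (p : X.OrbitSpace) :
    0 < X.orbitTrivialCard p := trivialCard_pos d _

end TopGroupoid

/-! ### Locally trivial isotropy in the charts of an atlas -/

namespace GoodAtlas

variable {d : ℕ} {X : TopGroupoid.{u}} [SSEStructure d X] {ι : Type u} (A : GoodAtlas d X ι)

/-- The map `emb i g` is a continuous section of the source map, which is locally injective. -/
theorem eventually_eq_emb {i : ι} (g : A.G i) (x : (A.chart i).source) :
    ∀ᶠ γ in 𝓝 (A.emb i g x), ∃ h : X.src γ ∈ (A.chart i).source, A.emb i g ⟨X.src γ, h⟩ = γ := by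
  obtain ⟨T, hT, hxT, hinj⟩ := (isLocalHomeomorph_src d X).isLocallyInjective (A.emb i g x)
  have h1 : ∀ᶠ y in 𝓝 x, A.emb i g y ∈ T := (A.continuous_emb i g).continuousAt (hT.mem_nhds hxT)
  rw [nhds_subtype, eventually_comap] at h1
  rw [← A.src_emb i g x] at h1
  have h2 : X.src (A.emb i g x) ∈ (A.chart i).source := by rw [A.src_emb]; exact x.2
  filter_upwards [hT.mem_nhds hxT, X.continuous_src.continuousAt.eventually h1,
    X.continuous_src.continuousAt ((A.chart i).open_source.mem_nhds h2)] with γ h3 h4 h5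
  exact ⟨h5, hinj (h4 _ rfl) h3 (A.src_emb ..)⟩

open Classical in
/-- The action of an element of the group of a chart on the chart domain, extended by the identity
to the object space. -/
def extend {i : ι} (g : A.G i) (z : X.Obj) : X.Obj :=
  if h : z ∈ (A.chart i).source then (g • (⟨z, h⟩ : (A.chart i).source) : (A.chart i).source) else z

theorem extend_coe {i : ι} (g : A.G i) (x : (A.chart i).source) :
    A.extend g x = (g • x : (A.chart i).source) := dif_pos x.2

/-- Near x, the action of g is the target map after the local inverse of the source map at `emb i g
x`. -/
theorem contMDiffAt_extend {i : ι} (g : A.G i) (x : (A.chart i).source) :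
    ContMDiffAt (𝓡 d) (𝓡 d) ∞ (A.extend g) x := by
  have hsrc := (SSEStructure.src_etale (d := d) (X := X)).1 (A.emb i g x)
  have htgt := (SSEStructure.tgt_etale (d := d) (X := X)).1.contMDiff
  have h1 := hsrc.localInverse_contMDiffAt
  rw [A.src_emb] at h1
  refine (htgt.contMDiffAt.comp (x : X.Obj) h1).congr_of_eventuallyEq ?_
  have h2 := (A.continuous_emb i g).continuousAt.eventually hsrc.localInverse_eventuallyEq_left
  rw [nhds_subtype, eventually_comap] at h2
  filter_upwards [h2, (A.chart i).open_source.mem_nhds x.2] with z hz hz'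
  have h3 := hz ⟨z, hz'⟩ rfl
  simp only [Function.comp_apply, A.src_emb, id] at h3
  rw [Function.comp_apply, h3, A.tgt_emb]
  exact A.extend_coe g ⟨z, hz'⟩

/-- In the chart, g is a smooth map with period `orderOf g` on a connected open subset of ℝ^d, so
`eqOn_of_iterate` applies. -/
theorem smul_eq_of_eventually {i : ι} (g : A.G i) (x : (A.chart i).source)
    (h : ∀ᶠ y in 𝓝 x, g • y = y) (y : (A.chart i).source) : g • y = y := by
  let φ := (A.chart i) ∘ A.extend g ∘ (A.chart i).symm
  have hφ (y : (A.chart i).source) : φ ((A.chart i) y) = (A.chart i) (g • y : (A.chart i).source) := by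
    simp only [φ, Function.comp_apply, (A.chart i).left_inv y.2, A.extend_coe g y]
  have hiter (k : ℕ) (y : (A.chart i).source) : φ^[k] ((A.chart i) y) = (A.chart i) (g ^ k • y : (A.chart i).source) := by
    induction k with
    | zero => simp
    | succ k ih => rw [Function.iterate_succ_apply', ih, hφ, pow_succ', mul_smul]
  have hsurj : ∀ v ∈ (A.chart i).target, ∃ y : (A.chart i).source, (A.chart i) y = v := fun v hv =>
    ⟨⟨(A.chart i).symm v, (A.chart i).map_target hv⟩, (A.chart i).right_inv hv⟩
  have hsmooth : ContDiffOn ℝ 1 φ (A.chart i).target := by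
    intro v hv
    obtain ⟨y, rfl⟩ := hsurj v hv
    have h1 := contMDiffAt_symm_of_mem_maximalAtlas (A.chart_mem i) hv
    have h2 := A.contMDiffAt_extend g y
    have h3 := contMDiffAt_of_mem_maximalAtlas (A.chart_mem i) (g • y).2
    have e1 : (A.chart i).symm ((A.chart i) y) = y := (A.chart i).left_inv y.2
    have e2 : A.extend g ((A.chart i).symm ((A.chart i) y)) = (g • y : (A.chart i).source) := by rw [e1, A.extend_coe]
    rw [← e1] at h2
    rw [← e2] at h3
    have h4 := h3.comp ((A.chart i) y) (h2.comp ((A.chart i) y) h1)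
    exact ((contMDiffAt_iff_contDiffAt.1 h4).of_le (by simp)).contDiffWithinAt
  have hper : ∀ v ∈ (A.chart i).target, φ^[orderOf g] v = v := by
    intro v hv
    obtain ⟨y, rfl⟩ := hsurj v hv
    rw [hiter, pow_orderOf_eq_one, one_smul]
  have hnear : ∀ᶠ v in 𝓝 ((A.chart i) x), φ v = v := by
    rw [nhds_subtype, eventually_comap] at h
    have h1 := (A.chart i).continuousAt_symm ((A.chart i).map_source x.2)
    rw [ContinuousAt, (A.chart i).left_inv x.2] at h1
    filter_upwards [h1.eventually h, (A.chart i).open_target.mem_nhds ((A.chart i).map_source x.2)] with v hv hv'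
    obtain ⟨y, rfl⟩ := hsurj v hv'
    rw [hφ, hv y ((A.chart i).left_inv y.2).symm]
  have h1 := eqOn_of_iterate (A.chart i).open_target (A.connected i).isPreconnected hsmooth
    (orderOf_pos g).ne' hper ((A.chart i).map_source x.2) hnear ((A.chart i) y) ((A.chart i).map_source y.2)
  rw [hφ] at h1
  exact Subtype.ext ((A.chart i).injOn (g • y).2 y.2 h1)

theorem isLocallyTrivial_emb_iff {i : ι} (g : A.G i) (x : (A.chart i).source) :
    IsLocallyTrivial (A.emb i g x) ↔ ∀ y : (A.chart i).source, g • y = y := by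
  refine ⟨fun h => A.smul_eq_of_eventually g x ?_, fun h => ?_⟩
  · filter_upwards [(A.continuous_emb i g).continuousAt.eventually h] with y hy
    rw [A.src_emb, A.tgt_emb] at hy
    exact Subtype.ext hy.symm
  · filter_upwards [A.eventually_eq_emb g x]
    rintro γ ⟨hγ, h1⟩
    rw [← h1, A.src_emb, A.tgt_emb, h]

/-- The right side is the order of the kernel of the action on the chart; its independence of x
makes the count constant on each |Uᵢ|. -/
theorem trivialCard_eq_card {i : ι} (x : (A.chart i).source) :
    X.trivialCard x = Nat.card {g : A.G i // ∀ y : (A.chart i).source, g • y = y} := by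
  symm
  refine Nat.card_congr (Equiv.ofBijective (fun g => ⟨⟨A.emb i g.1 x, A.src_emb .., by
    rw [A.tgt_emb, g.2]⟩, (A.isLocallyTrivial_emb_iff g.1 x).2 g.2⟩) ⟨fun g h H => ?_, ?_⟩)
  · exact Subtype.ext (A.emb_injective_left (congrArg (fun ε => ε.1.1) H))
  · rintro ⟨⟨γ, h1, h2⟩, h3⟩
    obtain ⟨g, rfl⟩ := A.exists_emb_eq x h1 (by rw [h2]; exact x.2)
    exact ⟨⟨g, (A.isLocallyTrivial_emb_iff g x).1 h3⟩, rfl⟩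

include A in
theorem isLocallyConstant_orbitTrivialCard : IsLocallyConstant X.orbitTrivialCard := by
  rw [IsLocallyConstant.iff_eventually_eq]
  intro p
  obtain ⟨x, rfl⟩ := proj_surjective p
  obtain ⟨i, hi⟩ := mem_iUnion.1 (A.cover.symm ▸ mem_univ x)
  filter_upwards [(A.isOpen_cell i).mem_nhds ⟨x, hi, rfl⟩]
  rintro _ ⟨y, hy, rfl⟩
  rw [orbitTrivialCard_proj d, orbitTrivialCard_proj d, A.trivialCard_eq_card ⟨x, hi⟩,
    A.trivialCard_eq_card ⟨y, hy⟩]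

end GoodAtlas
end Orbi
end

noncomputable section
namespace Orbi

open TopGroupoid

namespace CompatibleCover

variable {d : ℕ} {X : TopGroupoid.{u}} [SSEStructure d X] {ι : Type u} [LinearOrder ι]
  {A : GoodAtlas d X ι} {𝒱 : CompatibleCover A}

/-! ### The weighting -/

/-- The tuples with index set `I` that are objects of the groupoid of a cover. -/
abbrev Over (𝒱 : CompatibleCover A) (I : IndexSet ι) : Type u := {z : Tuple A I // z.proj ∈ 𝒱.V I}

/-- The projection from the tuples with index set `I` to the maximal Hausdorff quotient. -/
def overProj (𝒱 : CompatibleCover A) (I : IndexSet ι) (z : 𝒱.Over I) :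
    𝒱.groupoid.HausdorffOrbitSpace := 𝒱.groupoid.projH (⟨I, z⟩ : 𝒱.TupleObj)

theorem continuous_overProj (I : IndexSet ι) : Continuous (𝒱.overProj I) := by
  have h := continuous_sigmaMk (σ := fun I => 𝒱.Over I) (i := I)
  exact isQuotientMap_projH.continuous.comp h

theorem projH_surjective (q : 𝒱.groupoid.HausdorffOrbitSpace) :
    ∃ a : 𝒱.TupleObj, 𝒱.groupoid.projH a = q := isQuotientMap_projH.surjective q

/-- The map on orbit spaces induced by the projection of the groupoid of a cover to `X`. -/
def orbitMap (𝒱 : CompatibleCover A) : 𝒱.groupoid.OrbitSpace → X.OrbitSpace :=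
  Quotient.lift (fun a : 𝒱.TupleObj => toOrbit a) fun _ _ hab =>
    (eqvGen_iff.1 (groupoid_proj_eq_iff.1
      (Quotient.sound (s := 𝒱.groupoid.orbitSetoid) hab))).toOrbit_eq

theorem continuous_orbitMap : Continuous 𝒱.orbitMap :=
  Continuous.quotient_lift (s := 𝒱.groupoid.orbitSetoid) 𝒱.continuous_toOrbit _

variable [T2Space X.OrbitSpace]

/-- The map on the maximal Hausdorff quotient induced by the projection of the groupoid of a cover
to `X`. -/
def hausdorffMap (𝒱 : CompatibleCover A) : 𝒱.groupoid.HausdorffOrbitSpace → X.OrbitSpace :=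
  T2Quotient.lift 𝒱.continuous_orbitMap

theorem continuous_hausdorffMap : Continuous 𝒱.hausdorffMap := T2Quotient.continuous_lift _

/-- The weighting of the groupoid of a cover. -/
def weight (𝒱 : CompatibleCover A) (q : 𝒱.groupoid.HausdorffOrbitSpace) : ℝ :=
  (X.orbitTrivialCard (𝒱.hausdorffMap q) : ℝ) / (A.groupCard (𝒱.clow (𝒱.hausdorffMap q)) : ℝ)

theorem weight_pos (q : 𝒱.groupoid.HausdorffOrbitSpace) : 0 < 𝒱.weight q :=
  div_pos (Nat.cast_pos.2 (orbitTrivialCard_pos d _)) (Nat.cast_pos.2 (A.groupCard_pos _))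

theorem overProj_eq_iff {I : IndexSet ι} {z z' : 𝒱.Over I} :
    𝒱.overProj I z = 𝒱.overProj I z' ↔
      z.1.restrict (𝒱.clow_subset_of_mem z.2) = z'.1.restrict (𝒱.clow_subset_of_mem z.2) :=
  projH_eq_iff.trans ⟨fun h => h.2.2, fun h => ⟨_, _, h⟩⟩

omit [T2Space X.OrbitSpace] in
-- I is comparable with the index set of a: either a restricts to an I-tuple, or it lifts to one.
theorem exists_over_proj_eq {a : 𝒱.TupleObj} {I : IndexSet ι} (h : toOrbit a ∈ 𝒱.V I) :
    ∃ z : 𝒱.Over I, 𝒱.groupoid.proj (⟨I, z⟩ : 𝒱.TupleObj) = 𝒱.groupoid.proj a := by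
  rcases 𝒱.subset_or_subset (subset_closure h) (subset_closure (toOrbit_mem a)) with h1 | h1
  · let b : 𝒱.TupleObj := ⟨I, a.2.1.restrict h1, by rwa [Tuple.proj_restrict]⟩
    exact ⟨b.2, groupoid_proj_eq_iff.2 (Relation.EqvGen.rel a b ⟨h1, rfl⟩).symm⟩
  · obtain ⟨z, hz⟩ := Tuple.exists_restrict_eq h1 a.2.1 (𝒱.mem_cell_of_mem h)
    have h2 : z.proj = toOrbit a := by rw [toOrbit, ← hz, Tuple.proj_restrict]
    exact ⟨⟨z, h2 ▸ h⟩, groupoid_proj_eq_iff.2 (Relation.EqvGen.rel _ _ ⟨h1, hz⟩)⟩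

theorem exists_overProj_eq {q : 𝒱.groupoid.HausdorffOrbitSpace} {I : IndexSet ι}
    (h : 𝒱.hausdorffMap q ∈ 𝒱.V I) : ∃ z : 𝒱.Over I, 𝒱.overProj I z = q := by
  obtain ⟨a, rfl⟩ := projH_surjective q
  obtain ⟨z, hz⟩ := exists_over_proj_eq (a := a) h
  exact ⟨z, projH_eq_of_proj_eq hz⟩

omit [T2Space X.OrbitSpace] in
theorem le_nhds_of_map_subtypeVal {Y : Type*} [TopologicalSpace Y] {P : Y → Prop} {y : Subtype P}
    {ℱ : Filter (Subtype P)} (h : map Subtype.val ℱ ≤ 𝓝 y.1) : ℱ ≤ 𝓝 y :=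
  IsInducing.subtypeVal.nhds_eq_comap y ▸ map_le_iff_le_comap.1 h

omit [T2Space X.OrbitSpace] in
theorem over_ultrafilter_le_nhds (hX : X.IsProper) {I : IndexSet ι} {w : X.OrbitSpace}
    (hw : w ∈ 𝒱.V I) {𝒲 : Ultrafilter (𝒱.Over I)}
    (h : Tendsto (fun z : 𝒱.Over I => z.1.proj) (𝒲 : Filter (𝒱.Over I)) (𝓝 w)) :
    ∃ z : 𝒱.Over I, z.1.proj = w ∧ ↑𝒲 ≤ 𝓝 z := by
  obtain ⟨z, hz, hle⟩ := Tuple.exists_ultrafilter_le_nhds hX (𝒱.mem_cell_of_mem hw)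
    (𝒲 := 𝒲.map Subtype.val) (by rwa [Ultrafilter.coe_map, tendsto_map'_iff])
  refine ⟨⟨z, hz ▸ hw⟩, hz, ?_⟩
  exact le_nhds_of_map_subtypeVal hle

/-- Over |V_I| the Hausdorff quotient is covered by the I-tuples. An ultrafilter with image tending
to w ∈ |V_I| lifts to them and converges there, since their projection to |V_I| is proper. -/
theorem isProperMap_hausdorffMap (hX : X.IsProper) : IsProperMap 𝒱.hausdorffMap := by
  refine isProperMap_iff_ultrafilter.2 ⟨continuous_hausdorffMap, fun 𝒰 w h => ?_⟩
  obtain ⟨I, hI⟩ := 𝒱.exists_mem w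
  have h1 : range (𝒱.overProj I) ∈ 𝒰 := by
    filter_upwards [h ((𝒱.isOpen I).mem_nhds hI)] with q hq using exists_overProj_eq hq
  have h2 : (comap (𝒱.overProj I) (𝒰 : Filter _)).NeBot := 𝒰.neBot.comap_of_range_mem h1
  let 𝒲 := Ultrafilter.of (comap (𝒱.overProj I) (𝒰 : Filter _))
  have h3 : 𝒲.map (𝒱.overProj I) = 𝒰 :=
    Ultrafilter.eq_of_le (map_le_iff_le_comap.2 (Ultrafilter.of_le _))
  rw [← h3, Ultrafilter.coe_map, tendsto_map'_iff] at h
  obtain ⟨z, hz, hle⟩ := over_ultrafilter_le_nhds hX hI h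
  refine ⟨𝒱.overProj I z, hz, ?_⟩
  rw [← h3]
  exact (map_mono hle).trans (continuous_overProj I).continuousAt

/-! ### Local branches -/

omit [T2Space X.OrbitSpace] in
-- Over a small N the I-tuples split into disjoint open sheets, one for each tuple over w, on which
-- every object is an injective coordinate.
theorem exists_sheets (hX : X.IsProper) {w : X.OrbitSpace} {I : IndexSet ι} (hw : w ∈ 𝒱.V I) :
    ∃ (N : Set X.OrbitSpace) (T : {z : Tuple A I // z.proj = w} → Set (Tuple A I)),
      IsOpen N ∧ w ∈ N ∧ N ⊆ 𝒱.V I ∧ (∀ w' ∈ N, (𝒱.clow w).1 ⊆ (𝒱.clow w').1) ∧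
      (∀ w' ∈ N, X.orbitTrivialCard w' = X.orbitTrivialCard w) ∧ (∀ z, IsOpen (T z)) ∧
      (Pairwise fun z z' => Disjoint (T z) (T z')) ∧
      (∀ z' : Tuple A I, z'.proj ∈ N → ∃ z, z' ∈ T z) ∧
      ∀ z, ∀ k : I.1, InjOn (fun z' : Tuple A I => z'.obj k) (T z) := by
  have hfin := Tuple.finite_proj_fibre (𝒱.mem_cell_of_mem hw)
  obtain ⟨O, hO, hOdisj⟩ := Set.Finite.t2_separation (s := {z : Tuple A I | z.proj = w}) hfin
  choose Q hQ hQinj using Tuple.exists_injOn_obj (A := A) (I := I)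
  let T : {z : Tuple A I // z.proj = w} → Set (Tuple A I) := fun z => O z ∩ interior (Q z)
  have hT (z) : IsOpen (T z) := (hO z).2.inter isOpen_interior
  -- By properness, an ultrafilter of tuples whose images tend to w converges to some tuple over w,
  -- so it contains the sheet of that tuple.
  have h1 : ∀ᶠ w' in 𝓝 w, ∀ z' : Tuple A I, z'.proj = w' → ∃ z, z' ∈ T z := by
    rw [← eventually_comap]
    refine mem_iff_ultrafilter.2 fun 𝒲 h𝒲 => ?_
    obtain ⟨z, hz, hle⟩ := Tuple.exists_ultrafilter_le_nhds hX (𝒱.mem_cell_of_mem hw)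
      (tendsto_iff_comap.2 h𝒲)
    filter_upwards [hle ((hT ⟨z, hz⟩).mem_nhds ⟨(hO z).1, mem_interior_iff_mem_nhds.2 (hQ z)⟩)]
      with z' hz' using ⟨_, hz'⟩
  obtain ⟨N, hN, hNo, hwN⟩ := eventually_nhds_iff.1 (((h1.and (𝒱.eventually_clow_subset w)).and
    ((𝒱.isOpen I).mem_nhds hw)).and
      (A.isLocallyConstant_orbitTrivialCard.eventually_eq w))
  refine ⟨N, T, hNo, hwN, fun w' hw' => (hN w' hw').1.2, fun w' hw' => (hN w' hw').1.1.2,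
    fun w' hw' => (hN w' hw').2, hT, fun z z' hzz' => ?_, fun z' hz' => (hN _ hz').1.1.1 z' rfl,
    fun z k => (hQinj z.1 k).mono (inter_subset_right.trans interior_subset)⟩
  exact (hOdisj z.2 z'.2 fun h => hzz' (Subtype.ext h)).mono inter_subset_left inter_subset_left

omit [T2Space X.OrbitSpace] in
theorem isEmbedding_domRestrict_image {Y Z W : Type*} [TopologicalSpace Y] [TopologicalSpace Z]
    [TopologicalSpace W] {j : Y → Z} (hj : IsEmbedding j) {f : Z → W} {S : Set Y}
    (h : IsEmbedding (S.domRestrict (f ∘ j))) : IsEmbedding ((j '' S).domRestrict f) := by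
  convert h.comp (hj.homeomorphImage S).symm.isEmbedding using 1
  ext x
  obtain ⟨y, rfl⟩ := (hj.homeomorphImage S).surjective x
  simp only [Function.comp_apply, Homeomorph.symm_apply_apply]
  rfl

theorem exists_isLocalBranching (hX : X.IsProper) (p : 𝒱.groupoid.HausdorffOrbitSpace) :
    ∃ (N : Set 𝒱.groupoid.HausdorffOrbitSpace) (ℓ : ℕ) (U : Fin ℓ → Set 𝒱.groupoid.Obj)
      (m : Fin ℓ → ℝ), p ∈ N ∧ IsLocalBranching 𝒱.groupoid 𝒱.weight N U m := by
  set w := 𝒱.hausdorffMap p with hw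
  obtain ⟨I, hI⟩ := 𝒱.exists_mem w
  obtain ⟨N, T, hN, hwN, hNI, hNlow, hNκ, hT, hTdisj, hTcov, hTinj⟩ := exists_sheets hX hI
  have hfin := Tuple.finite_proj_fibre (𝒱.mem_cell_of_mem hI)
  let e := (Finite.equivFin {z : Tuple A I // z.proj = w}).symm
  let S (z : {z : Tuple A I // z.proj = w}) : Set (𝒱.Over I) :=
    {z' | z'.1 ∈ T z ∧ z'.1.proj ∈ N}
  have hSopen (z) : IsOpen (S z) :=
    ((hT z).preimage continuous_subtype_val).inter
      (hN.preimage (Tuple.continuous_proj.comp continuous_subtype_val))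
  have hSdisj {z z'} {x : 𝒱.Over I} (h : x.1 ∈ T z) (h' : x.1 ∈ T z') : z = z' := by
    by_contra hne
    exact disjoint_left.1 (hTdisj hne) h h'
  -- Points of a sheet with equal image agree on their `clow`, which contains `clow w` throughout N;
  -- a common object with index there forces equality within the sheet.
  have hinj (z) : InjOn (𝒱.overProj I) (S z) := by
    intro x hx y hy hxy
    have h1 := overProj_eq_iff.1 hxy
    have h2 := hNlow _ hx.2 (𝒱.clow w).first.2
    exact Subtype.ext (hTinj z ⟨_, 𝒱.clow_subset_of_mem x.2 h2⟩ hx.1 hy.1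
      (congrArg (fun v => v.obj ⟨_, h2⟩) h1))
  let g (z) (x : S z) : 𝒱.hausdorffMap ⁻¹' N := ⟨𝒱.overProj I x.1, x.2.2⟩
  have hgcont (z) : Continuous (g z) :=
    ((continuous_overProj I).comp continuous_subtype_val).subtype_mk _
  -- The limit given by properness lies in some sheet; an ultrafilter on the sheet of z cannot
  -- approach a different one, so the limit stays in it. This makes the image of a branch relatively
  -- closed.
  have hgproper (z) : IsProperMap (g z) := by
    refine isProperMap_iff_ultrafilter_of_t2.2 ⟨hgcont z, fun 𝒲 q hq => ?_⟩
    have h1 : Tendsto (fun x : S z => x.1.1.proj) 𝒲 (𝓝 (𝒱.hausdorffMap q)) :=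
      ((continuous_hausdorffMap.comp continuous_subtype_val).tendsto q).comp hq
    obtain ⟨x, hx, hle⟩ := over_ultrafilter_le_nhds hX (hNI q.2)
      (𝒲 := 𝒲.map Subtype.val) (by rwa [Ultrafilter.coe_map, tendsto_map'_iff])
    have hxN : x.1.proj ∈ N := hx ▸ q.2
    obtain ⟨z', hz'⟩ := hTcov x.1 hxN
    have h2 : ∀ᶠ y : S z in (𝒲 : Filter (S z)), y.1.1 ∈ T z' :=
      hle (((hT z').preimage continuous_subtype_val).mem_nhds hz')
    obtain ⟨y, hy⟩ := h2.exists
    obtain rfl : z = z' := hSdisj y.2.1 hy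
    refine ⟨⟨x, hz', hxN⟩, ?_⟩
    exact le_nhds_of_map_subtypeVal hle
  have hgemb (z) : IsClosedEmbedding (g z) :=
    .of_continuous_injective_isClosedMap (hgcont z) (fun x y hxy =>
      Subtype.ext (hinj z x.2 y.2 (congrArg Subtype.val hxy))) (hgproper z).isClosedMap
  let U (z) : Set 𝒱.TupleObj := Sigma.mk I '' S z
  have hUimage (z) : 𝒱.groupoid.projH '' U z = 𝒱.overProj I '' S z := image_image _ _ _
  -- The branches through the image of x correspond to the I-tuples with the same restriction to K =
  -- `clow`, and there are |G_I|/|G_K| of these.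
  have hweight : ∀ q, 𝒱.hausdorffMap q ∈ N →
      𝒱.weight q = Nat.card {z // q ∈ 𝒱.groupoid.projH '' U z} *
        ((X.orbitTrivialCard w : ℝ) / (A.groupCard I : ℝ)) := by
    intro q hq
    obtain ⟨x, rfl⟩ := exists_overProj_eq (hNI hq)
    have hK := 𝒱.clow_subset_of_mem x.2
    have h1 := Tuple.card_restrict_fibre hK (x.1.restrict hK)
      (by rw [Tuple.proj_restrict]; exact 𝒱.mem_cell_of_mem x.2)
    have hS (z : {z // 𝒱.overProj I x ∈ 𝒱.groupoid.projH '' U z}) :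
        ∃ y ∈ S z, 𝒱.overProj I y = 𝒱.overProj I x := by
      have := z.2
      rwa [hUimage] at this
    choose y hy hyx using hS
    have h2 : Nat.card {z // 𝒱.overProj I x ∈ 𝒱.groupoid.projH '' U z} =
        Nat.card {v : Tuple A I // v.restrict hK = x.1.restrict hK} := by
      refine Nat.card_congr (Equiv.ofBijective
        (fun z => ⟨(y z).1, (overProj_eq_iff.1 (hyx z).symm).symm⟩) ⟨fun z z' hzz' => ?_, ?_⟩)
      · have h3 : y z = y z' := Subtype.ext (by simpa using hzz')
        exact Subtype.ext (hSdisj (hy z).1 (h3 ▸ (hy z').1))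
      · rintro ⟨v, hv⟩
        have h3 : v.proj = x.1.proj := by
          rw [← Tuple.proj_restrict hK v, hv, Tuple.proj_restrict]
        have hvN : v.proj ∈ N := h3 ▸ hq
        let v' : 𝒱.Over I := ⟨v, hNI hvN⟩
        obtain ⟨z, hz⟩ := hTcov v hvN
        have h4 : 𝒱.overProj I v' = 𝒱.overProj I x := (overProj_eq_iff.2 hv.symm).symm
        have h5 : 𝒱.overProj I x ∈ 𝒱.groupoid.projH '' U z := by
          rw [hUimage]
          exact ⟨v', ⟨hz, hvN⟩, h4⟩
        have h6 : y ⟨z, h5⟩ = v' :=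
          hinj z (hy ⟨z, h5⟩) (⟨hz, hvN⟩ : v' ∈ S z) ((hyx ⟨z, h5⟩).trans h4.symm)
        exact ⟨⟨z, h5⟩, Subtype.ext (show (y ⟨z, h5⟩).1 = v from Subtype.ext_iff.1 h6)⟩
    rw [h2, weight, hNκ _ hq, h1]
    change _ / (A.groupCard (𝒱.clow x.1.proj) : ℝ) = _
    have h3 : (A.groupCard (𝒱.clow x.1.proj) : ℝ) ≠ 0 :=
      Nat.cast_ne_zero.2 (A.groupCard_pos _).ne'
    have h4 : (Nat.card {v : Tuple A I // v.restrict hK = x.1.restrict hK} : ℝ) ≠ 0 := by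
      refine Nat.cast_ne_zero.2 fun h0 => (A.groupCard_pos I).ne' ?_
      rw [h1, h0, zero_mul]
    rw [Nat.cast_mul]
    field_simp
  refine ⟨𝒱.hausdorffMap ⁻¹' N, _, fun i => U (e i), fun _ =>
    (X.orbitTrivialCard w : ℝ) / (A.groupCard I : ℝ), hwN, ?_⟩
  refine
    { isOpen_nhd := hN.preimage continuous_hausdorffMap
      isOpen_branch := fun i => isOpenMap_sigmaMk _ (hSopen _)
      branch_subset := ?_
      disjoint := fun i j hij => ?_
      weight_pos := fun i => div_pos (Nat.cast_pos.2 (orbitTrivialCard_pos d _))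
        (Nat.cast_pos.2 (A.groupCard_pos _))
      covering := ?_
      embedding := fun i => isEmbedding_domRestrict_image
        (Topology.IsEmbedding.sigmaMk (σ := fun I => 𝒱.Over I) (i := I))
        (IsEmbedding.subtypeVal.comp (hgemb (e i)).isEmbedding)
      closed := fun i => ?_
      weighting := fun q hq => ?_ }
  · rintro i _ ⟨x, hx, rfl⟩
    exact hx.2
  · refine Set.disjoint_left.2 ?_
    rintro _ ⟨x, hx, rfl⟩ ⟨y, hy, hxy⟩
    obtain rfl : y = x := eq_of_heq (Sigma.mk.inj hxy).2
    exact hij (e.injective (hSdisj hx.1 hy.1))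
  · ext P
    obtain ⟨a, rfl⟩ := proj_surjective P
    constructor
    · intro ha
      have haN : toOrbit (𝒱 := 𝒱) a ∈ N := ha
      obtain ⟨x, hx⟩ := exists_over_proj_eq (𝒱 := 𝒱) (hNI haN)
      have hxN : x.1.proj ∈ N := by
        have := congrArg 𝒱.hausdorffMap (projH_eq_of_proj_eq hx)
        exact (show x.1.proj = toOrbit a from this) ▸ haN
      obtain ⟨z, hz⟩ := hTcov x.1 hxN
      obtain ⟨i, rfl⟩ := e.surjective z
      exact mem_iUnion.2 ⟨i, ⟨I, x⟩, ⟨x, ⟨hz, hxN⟩, rfl⟩, hx⟩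
    · intro ha
      obtain ⟨i, _, ⟨x, hx, rfl⟩, hxa⟩ := mem_iUnion.1 ha
      rw [← hxa]
      exact hx.2
  · obtain ⟨C, hC, hCg⟩ := isClosed_induced_iff.1 (hgemb (e i)).isClosed_range
    refine ⟨C, hC, ?_⟩
    rw [hUimage, inter_comm, ← Subtype.image_preimage_coe, hCg]
    ext q
    constructor
    · rintro ⟨x, hx, rfl⟩
      exact ⟨_, ⟨⟨x, hx⟩, rfl⟩, rfl⟩
    · rintro ⟨_, ⟨⟨x, hx⟩, rfl⟩, rfl⟩
      exact ⟨x, hx, rfl⟩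
  · classical
    rw [hweight q hq]
    have h1 : Nat.card {z // q ∈ 𝒱.groupoid.projH '' U z} =
        Nat.card {i // q ∈ 𝒱.groupoid.projH '' U (e i)} :=
      (Nat.card_congr (e.subtypeEquiv fun _ => Iff.rfl)).symm
    rw [h1, Nat.card_eq_fintype_card, Fintype.card_subtype]
    simp only [Set.indicator_apply]
    rw [← Finset.sum_filter, Finset.sum_const, nsmul_eq_mul]

theorem isWNB (hX : X.IsProper) :
    letI := 𝒱.sseStructure
    IsWNB d 𝒱.groupoid 𝒱.weight :=
  letI := 𝒱.sseStructure
  { nonsingular := 𝒱.isNonsingular_groupoid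
    pos := weight_pos
    branching := exists_isLocalBranching hX }

/-! ### The projection is a resolution -/

/-- With K = `clow w`, restriction identifies the fibre with the K-tuples over w. There are
|G_K|/|G_x| of them, each of weight |G_x|/|G_K| because κ = |G_x| at a smooth point. -/
theorem hasSum_weight {w : X.OrbitSpace} (hw : X.IsSmoothPoint w) :
    HasSum (fun q : {q // 𝒱.hausdorffMap q = w} => 𝒱.weight q.1) 1 := by
  obtain ⟨x₀, rfl⟩ := proj_surjective w
  set K := 𝒱.clow (X.proj x₀)
  obtain ⟨I, hI⟩ := 𝒱.exists_mem (X.proj x₀)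
  have hKI : K.1 ⊆ I.1 := 𝒱.clow_subset_of_mem hI
  have hcellK := 𝒱.mem_cell_of_mem_closure (𝒱.mem_clow (X.proj x₀))
  have hcell := 𝒱.mem_cell_of_mem hI
  have hfin := Tuple.finite_proj_fibre hcellK
  have h1 := Tuple.card_proj_fibre x₀ hcellK
  have hlift (v : {v : Tuple A K // v.proj = X.proj x₀}) :
      ∃ z : 𝒱.Over I, z.1.restrict hKI = v.1 := by
    obtain ⟨z, hz⟩ := Tuple.exists_restrict_eq hKI v.1 (by rw [v.2]; exact hcell)
    exact ⟨⟨z, by rw [← Tuple.proj_restrict hKI, hz, v.2]; exact hI⟩, hz⟩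
  choose z hz using hlift
  have hzproj (v) : (z v).1.proj = X.proj x₀ := by
    rw [← Tuple.proj_restrict hKI, hz, v.2]
  have hiff {y y' : 𝒱.Over I} (hy : y.1.proj = X.proj x₀) :
      𝒱.overProj I y = 𝒱.overProj I y' ↔ y.1.restrict hKI = y'.1.restrict hKI := by
    refine projH_eq_iff.trans ?_
    rw [show toOrbit (⟨I, y⟩ : 𝒱.TupleObj) = X.proj x₀ from hy]
    exact ⟨fun h => h.2.2, fun h => ⟨_, _, h⟩⟩
  -- K-tuples over w need not be objects, as w may lie only in the closure of |V_K|; they are lifted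
  -- to I-tuples with w ∈ |V_I|.
  let E : {v : Tuple A K // v.proj = X.proj x₀} ≃ {q // 𝒱.hausdorffMap q = X.proj x₀} :=
    Equiv.ofBijective (fun v => ⟨𝒱.overProj I (z v), hzproj v⟩) ⟨fun v v' h => by
      have h2 := (hiff (hzproj v)).1 (congrArg Subtype.val h)
      rw [hz, hz] at h2
      exact Subtype.ext h2, by
      rintro ⟨q, hq⟩
      obtain ⟨y, rfl⟩ := exists_overProj_eq (hq ▸ hI)
      have hy : y.1.proj = X.proj x₀ := hq
      refine ⟨⟨y.1.restrict hKI, by rw [Tuple.proj_restrict, hy]⟩, Subtype.ext ?_⟩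
      exact (hiff (hzproj _)).2 (hz _)⟩
  have hfin' : Finite {q // 𝒱.hausdorffMap q = X.proj x₀} := Finite.of_equiv _ E
  have := Fintype.ofFinite {q // 𝒱.hausdorffMap q = X.proj x₀}
  convert hasSum_fintype (fun q : {q // 𝒱.hausdorffMap q = X.proj x₀} => 𝒱.weight q.1) using 1
  have hconst : ∀ q ∈ (Finset.univ : Finset {q // 𝒱.hausdorffMap q = X.proj x₀}),
      𝒱.weight q.1 = (Nat.card (X.Stab x₀) : ℝ) / (A.groupCard K : ℝ) := by
    intro q _
    rw [weight, q.2, orbitTrivialCard_proj d, trivialCard_of_isSmoothPoint hw]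
  rw [Finset.sum_congr rfl hconst, Finset.sum_const, Finset.card_univ, nsmul_eq_mul,
    ← Nat.card_eq_fintype_card, ← Nat.card_congr E, ← mul_div_assoc, ← Nat.cast_mul, ← h1, div_self]
  exact Nat.cast_ne_zero.2 (A.groupCard_pos _).ne'

theorem isResolution_projHom (hX : X.IsProper) :
    letI := 𝒱.sseStructure
    IsResolution d 𝒱.weight 𝒱.projHom := by
  let := 𝒱.sseStructure
  exact ⟨𝒱.isSmoothFunctor_projHom, 𝒱.isOrientedLocalDiffeo_firstObj, 𝒱.hausdorffMap,
    fun _ => rfl, isProperMap_hausdorffMap hX, fun _ => hasSum_weight⟩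

end CompatibleCover

/-! ### Commensurability through the identity -/

/-- The identity functor. -/
def TopGroupoid.Hom.id (B : TopGroupoid.{u}) : B.Hom B where
  obj x := x
  mor γ := γ
  src_mor _ := rfl
  tgt_mor _ := rfl
  mor_one _ := rfl
  mor_comp _ _ _ := rfl

theorem isLayeredCovering_id {d : ℕ} {B : TopGroupoid.{u}} [SSEStructure d B]
    (Λ : B.HausdorffOrbitSpace → ℝ) : IsLayeredCovering d Λ Λ (TopGroupoid.Hom.id B) :=
  ⟨⟨contMDiff_id, contMDiff_id⟩, isOrientedLocalDiffeo_id, fun y => ⟨y, rfl⟩, fun q => q,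
    fun _ => rfl, isProperMap_id, fun p => hasSum_unique (fun q : {q // q = p} => Λ q.1)⟩

theorem IsResolution.isCommensurate {d : ℕ} {B X : TopGroupoid.{u}} [i : SSEStructure d B]
    [SSEStructure d X] {Λ : B.HausdorffOrbitSpace → ℝ} {F : B.Hom X} (h : IsResolution d Λ F)
    (hB : IsWNB d B Λ) : IsCommensurate d B X Λ :=
  ⟨B, i, Λ, TopGroupoid.Hom.id B, F, hB, isLayeredCovering_id Λ, h⟩

end Orbi
end

/-! ### The proposition -/

theorem proposition4p2 {d : ℕ} (X : Orbi.TopGroupoid.{u}) [Orbi.SSEStructure d X]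
    (hX : X.IsProper) {ι : Type u} [LinearOrder ι] (A : Orbi.GoodAtlas d X ι)
    (𝒱 : Orbi.CompatibleCover A) :
    ∃ (_ : Orbi.SSEStructure d 𝒱.groupoid) (Λ : 𝒱.groupoid.HausdorffOrbitSpace → ℝ)
      (F : 𝒱.groupoid.Hom X),
      𝒱.IsProjection F ∧
      Orbi.IsWNB d 𝒱.groupoid Λ ∧
      (∃ κ : X.OrbitSpace → ℕ, IsLocallyConstant κ ∧
        (∀ x : X.Obj, X.IsSmoothPoint (X.proj x) → κ (X.proj x) = Nat.card (X.Stab x)) ∧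
        ∀ (a : 𝒱.TupleObj) (I : Orbi.IndexSet ι), 𝒱.IsMinIndex a.2.1.proj I →
          Λ (𝒱.groupoid.projH a) = (κ a.2.1.proj : ℝ) / (A.groupCard I : ℝ)) ∧
      Orbi.IsResolution d Λ F ∧
      Orbi.IsCommensurate d 𝒱.groupoid X Λ := by
  have := Orbi.TopGroupoid.t2Space_orbitSpace d hX
  let := 𝒱.sseStructure
  have hW := Orbi.CompatibleCover.isWNB (𝒱 := 𝒱) hX
  have hR := Orbi.CompatibleCover.isResolution_projHom (𝒱 := 𝒱) hX
  refine ⟨𝒱.sseStructure, 𝒱.weight, 𝒱.projHom, Orbi.CompatibleCover.isProjection_projHom, hW,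
    ⟨X.orbitTrivialCard, A.isLocallyConstant_orbitTrivialCard, fun x hx => ?_, fun a I hI => ?_⟩,
    hR, hR.isCommensurate hW⟩
  · rw [Orbi.TopGroupoid.orbitTrivialCard_proj d, Orbi.TopGroupoid.trivialCard_of_isSmoothPoint hx]
  · rw [𝒱.eq_clow_of_isMinIndex hI]
    rfl
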